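/- **Setting.** Write $q=e^{2\pi i z}$, $z\in\mathbb H$. Let $\psi_0$ be a real, primitive, even, non-trivial Dirichlet character modulo $N_0$ and $\psi_1$ a real, primitive, odd Dirichlet character modulo $N_1$, such that $$\theta_0(z)=\sum_{n\ge 0}\psi_0(n)q^{n^2},\qquad \theta_1(z)=\sum_{n\ge 1}n\,\psi_1(n)q^{n^2}$$ have no zeros in $\mathbb H$. Let $k\in\frac12+\mathbb N$ (so $k\ge\frac32$), let $N\ge1$ be a multiple of $\operatorname{lcm}(4N_0^2,4N_1^2)$ and let $\psi$ be a Dirichlet character modulo $N$. For half-integral $\kappa\in\frac12+\mathbb Z$ and a character $\chi$ modulo $N$, let $M^!_\kappa(N,\chi)$ be the space of holomorphic $f:\mathbb H\to\mathbb C$ that are meromorphic at all cusps and satisfy $$\left(\tfrac cd\right)\epsilon_d^{2\kappa}(cz+d)^{-\kappa}f\!\left(\tfrac{az+b}{cz+d}\right)=\chi(d)f(z)\qquad\text{for all }\begin{pmatrix}a&b\\c&d\end{pmatrix}\in\Gamma_0(N),$$ where $\left(\frac cd\right)$ is the Kronecker symbol, $\epsilon_d=1$ if $d\equiv1\bmod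 4$, $\epsilon_d=i$ if $d\equiv3\bmod4$, and powers use the principal branch. With $D=\frac1{2\pi i}\frac{d}{dz}$ put $$\delta_0^{k-1}(f):=\theta_0^{-2}\,\theta_1\,D^{k-\frac32}(\theta_0 f),$$ and set $\ell(n):=(n+1)^{k-\frac32}/n^{k-1}$ for $n\in\mathbb Z\setminus\{0\}$ (with $0^0=1$), $\ell(0):=0$. **Statement.** The function $\ell:\mathbb Z\to\mathbb C$ is bounded, and $\delta_0^{k-1}$ is a linear map $$\delta_0^{k-1}:\ M^!_{2-k}(N,\psi)\longrightarrow M^!_k\!\left(N,\ \psi\cdot\left(\tfrac{-1}{\cdot}\right)\tfrac{\psi_1}{\psi_0}\right).$$ Moreover there are complex numbers $A_{n,l}$ ($n,l\in\mathbb Z$), independent of $f$, such that for every $f\in M^!_{2-k}(N,\psi)$ with Fourier expansion $f(z)=\sum_{n\ge -n_0}c_nq^n$, where $n_0\in\mathbb Z$, one has $\delta_0^{k-1}(f)(z)=\sum_{n\ge -n_0}b_nq^n$ with $$b_n=c_n\,\ell(n)\,n^{k-1}+\sum_{-n_0\le l<n}A_{n,l}\,c_l\quad(n\neq0),\qquad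 b_0=c_0+\sum_{-n_0\le l<0}A_{0,l}\,c_l .$$ That is, the leading term is $(n+1)^{k-\frac32}c_n$ for every $n$, including $n=0$. -/

import Mathlib

open scoped UpperHalfPlane MatrixGroups Manifold

noncomputable section

namespace HalfIntegralBol

/-- The Kronecker symbol `(c / d)` for integers `c` and **odd** integers `d`, of either sign:
`(c / d) = (c / sgn d) * (c / |d|)`, where `(c / |d|)` is the Jacobi symbol, `(c / 1) = 1`, and
`(c / -1)` is `-1` if `c < 0` and `1` if `0 ≤ c`. -/
def kroneckerOdd (c d : ℤ) : ℤ :=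
  (if c < 0 ∧ d < 0 then -1 else 1) * jacobiSym c d.natAbs

/-- `ε_d = 1` if `d ≡ 1 mod 4` and `ε_d = i` if `d ≡ 3 mod 4` (used for odd `d` only). -/
def eps (d : ℤ) : ℂ := if d % 4 = 1 then 1 else Complex.I

/-- The unnormalised weight `κ / 2` factor: `(c z + d) ^ (-κ / 2) * f (γ z)` with the principal
branch of the power, where `(c, d)` is the lower row of `γ`. -/
def preSlash (κ : ℤ) (f : ℍ → ℂ) (γ : SL(2, ℤ)) (z : ℍ) : ℂ :=
  (((γ 1 0 : ℤ) : ℂ) * (z : ℂ) + ((γ 1 1 : ℤ) : ℂ)) ^ (-(κ : ℂ) / 2) * f (γ • z)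

/-- The slash action of weight `k = κ / 2` (`κ` odd) of a matrix `γ ∈ Γ₀(N)`, `4 ∣ N`:
`(f |_k γ)(z) = (c / d) ε_d ^ (2 k) (c z + d) ^ (-k) f (γ z)`. -/
def slash (κ : ℤ) (f : ℍ → ℂ) (γ : SL(2, ℤ)) (z : ℍ) : ℂ :=
  (kroneckerOdd (γ 1 0) (γ 1 1) : ℂ) * eps (γ 1 1) ^ κ * preSlash κ f γ z

/-- `g` is meromorphic at the cusp `∞`: for some width `h`, it is near `∞` a function of
`q_h = exp (2 π i z / h)` that is meromorphic at `q_h = 0`. -/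
def MeromorphicAtInfty (g : ℍ → ℂ) : Prop :=
  ∃ h : ℕ, 0 < h ∧ ∃ F : ℂ → ℂ, MeromorphicAt F 0 ∧
    ∀ᶠ z : ℍ in UpperHalfPlane.atImInfty, g z = F (Function.Periodic.qParam (h : ℝ) (z : ℂ))

/-- `f` is a weakly holomorphic modular form of weight `κ / 2` (`κ` odd) for `Γ₀(N)` (`4 ∣ N`) and
the character `ψ`: it is holomorphic on `ℍ`, it satisfies `f |_{κ/2} γ = ψ(d) f` for all
`γ ∈ Γ₀(N)`, and it is meromorphic at all cusps `γ ∞`, `γ ∈ SL(2, ℤ)`. -/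
structure IsWeaklyHolomorphic (κ : ℤ) (N : ℕ) (ψ : DirichletCharacter ℂ N) (f : ℍ → ℂ) :
    Prop where
  holo : MDifferentiable 𝓘(ℂ) 𝓘(ℂ) f
  slash_eq : ∀ γ ∈ CongruenceSubgroup.Gamma0 N, ∀ z : ℍ,
    slash κ f γ z = ψ ((γ 1 1 : ℤ) : ZMod N) * f z
  meromorphic : ∀ γ : SL(2, ℤ), MeromorphicAtInfty (preSlash κ f γ)

theorem preSlash_add (κ : ℤ) (f g : ℍ → ℂ) (γ : SL(2, ℤ)) :
    preSlash κ (f + g) γ = preSlash κ f γ + preSlash κ g γ := by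
  funext z; simp [preSlash, mul_add]

theorem preSlash_smul (κ : ℤ) (a : ℂ) (f : ℍ → ℂ) (γ : SL(2, ℤ)) :
    preSlash κ (a • f) γ = a • preSlash κ f γ := by
  funext z; simp [preSlash]; ring

theorem qParam_mul_pow (a b : ℕ) (hb : 0 < b) (z : ℂ) :
    Function.Periodic.qParam ((a * b : ℕ) : ℝ) z ^ b = Function.Periodic.qParam (a : ℝ) z := by
  have hb' : (b : ℂ) ≠ 0 := by exact_mod_cast hb.ne'
  rw [Function.Periodic.qParam, Function.Periodic.qParam, ← Complex.exp_nat_mul]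
  congr 1
  push_cast
  rcases Nat.eq_zero_or_pos a with rfl | ha
  · simp
  · have ha' : (a : ℂ) ≠ 0 := by exact_mod_cast ha.ne'
    field_simp

theorem meromorphicAt_comp_pow {F : ℂ → ℂ} (hF : MeromorphicAt F 0) {b : ℕ} (hb : 0 < b) :
    MeromorphicAt (fun q : ℂ => F (q ^ b)) 0 := by
  have hF' : MeromorphicAt F ((fun q : ℂ => q ^ b) 0) := by simpa [hb.ne'] using hF
  exact hF'.comp_analyticAt (g := fun q : ℂ => q ^ b) (by fun_prop)

theorem MeromorphicAtInfty.add {f g : ℍ → ℂ} (hf : MeromorphicAtInfty f)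
    (hg : MeromorphicAtInfty g) : MeromorphicAtInfty (f + g) := by
  obtain ⟨a, ha, F, hF, hfF⟩ := hf
  obtain ⟨b, hb, G, hG, hgG⟩ := hg
  refine ⟨a * b, Nat.mul_pos ha hb, fun q => F (q ^ b) + G (q ^ a),
    (meromorphicAt_comp_pow hF hb).add (meromorphicAt_comp_pow hG ha), ?_⟩
  filter_upwards [hfF, hgG] with z h1 h2
  have e2 : Function.Periodic.qParam ((a * b : ℕ) : ℝ) (z : ℂ) ^ a
      = Function.Periodic.qParam (b : ℝ) (z : ℂ) := by
    rw [mul_comm a b]; exact qParam_mul_pow b a ha z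
  simp only [Pi.add_apply, h1, h2, qParam_mul_pow a b hb, e2]

theorem MeromorphicAtInfty.smul (c : ℂ) {f : ℍ → ℂ} (hf : MeromorphicAtInfty f) :
    MeromorphicAtInfty (c • f) := by
  obtain ⟨a, ha, F, hF, hfF⟩ := hf
  refine ⟨a, ha, fun q => c * F q, (MeromorphicAt.const c 0).mul hF, ?_⟩
  filter_upwards [hfF] with z h1
  simp [h1]

theorem meromorphicAtInfty_zero : MeromorphicAtInfty 0 :=
  ⟨1, one_pos, fun _ => 0, MeromorphicAt.const 0 0, Filter.Eventually.of_forall fun _ => rfl⟩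

/-- The complex vector space `M^!_{κ/2}(N, ψ)` of weakly holomorphic modular forms of weight
`κ / 2` for `Γ₀(N)` and the character `ψ`. -/
def WeaklyHolomorphicForms (κ : ℤ) (N : ℕ) (ψ : DirichletCharacter ℂ N) :
    Submodule ℂ (ℍ → ℂ) where
  carrier := {f | IsWeaklyHolomorphic κ N ψ f}
  add_mem' := by
    intro f g hf hg
    refine ⟨hf.holo.add hg.holo, fun γ hγ z => ?_, fun γ => ?_⟩
    · have h1 := hf.slash_eq γ hγ z
      have h2 := hg.slash_eq γ hγ z
      simp only [slash, preSlash_add, Pi.add_apply, mul_add] at h1 h2 ⊢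
      rw [h1, h2]
    · rw [preSlash_add]
      exact (hf.meromorphic γ).add (hg.meromorphic γ)
  zero_mem' := by
    refine ⟨mdifferentiable_const, fun γ _ z => by simp [slash, preSlash], fun γ => ?_⟩
    have : preSlash κ 0 γ = 0 := by funext z; simp [preSlash]
    rw [this]
    exact meromorphicAtInfty_zero
  smul_mem' := by
    intro a f hf
    refine ⟨hf.holo.const_smul a, fun γ hγ z => ?_, fun γ => ?_⟩
    · have h1 := hf.slash_eq γ hγ z
      simp only [slash, preSlash_smul, Pi.smul_apply, smul_eq_mul] at h1 ⊢
      linear_combination a * h1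
    · rw [preSlash_smul]
      exact (hf.meromorphic γ).smul a

/-- `q ^ n = exp (2 π i n z)`. -/
def qPow (n : ℤ) (z : ℍ) : ℂ := Complex.exp (2 * Real.pi * Complex.I * (n : ℂ) * (z : ℂ))

/-- `θ₀(z) = ∑_{n ≥ 0} χ(n) q ^ (n ^ 2)`, for a nontrivial character `χ`. -/
def theta0 {M : ℕ} (χ : DirichletCharacter ℂ M) (z : ℍ) : ℂ :=
  ∑' n : ℕ, χ (n : ZMod M) * qPow ((n : ℤ) ^ 2) z

/-- `θ₁(z) = ∑_{n ≥ 1} n χ(n) q ^ (n ^ 2)` (the term `n = 0` vanishes). -/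
def theta1 {M : ℕ} (χ : DirichletCharacter ℂ M) (z : ℍ) : ℂ :=
  ∑' n : ℕ, (n : ℂ) * χ (n : ZMod M) * qPow ((n : ℤ) ^ 2) z

/-- The operator `δ_a^{k-1}`, with `r = k - 3 / 2`:
`δ_a^{k-1}(f) = θ₀ ^ (3 a - 2) θ₁ ^ (1 - a) D ^ r (θ₀ ^ (1 - 3 a) θ₁ ^ a f)`,
where `D = (2 π i)⁻¹ d/dz`. -/
def bolOperator {N₀ N₁ : ℕ} (ψ₀ : DirichletCharacter ℂ N₀) (ψ₁ : DirichletCharacter ℂ N₁)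
    (a : ℤ) (r : ℕ) (f : ℍ → ℂ) (z : ℍ) : ℂ :=
  theta0 ψ₀ z ^ (3 * a - 2) * theta1 ψ₁ z ^ (1 - a) *
    (Derivative.normalizedDerivOfComplex^[r]
      (fun w => theta0 ψ₀ w ^ (1 - 3 * a) * theta1 ψ₁ w ^ a * f w)) z

/-- The character `(-1 / ·)` modulo `4`, with complex values. -/
def chiNegOne : DirichletCharacter ℂ 4 := ZMod.χ₄.ringHomComp (Int.castRingHom ℂ)

/-- The character `ψ · (-1 / ·) · ψ₁ / ψ₀` modulo `N`, for a common multiple `N` of `4 N₀²` and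
`4 N₁²`. -/
def targetCharacter {N N₀ N₁ : ℕ} (hN : Nat.lcm (4 * N₀ ^ 2) (4 * N₁ ^ 2) ∣ N)
    (ψ : DirichletCharacter ℂ N) (ψ₀ : DirichletCharacter ℂ N₀)
    (ψ₁ : DirichletCharacter ℂ N₁) : DirichletCharacter ℂ N :=
  ψ * DirichletCharacter.changeLevel
        (((Dvd.intro _ rfl).trans (Nat.dvd_lcm_left _ _)).trans hN : 4 ∣ N) chiNegOne
    * DirichletCharacter.changeLevel
        (((Dvd.intro_left (4 * N₁) (by ring)).trans (Nat.dvd_lcm_right _ _)).trans hN : N₁ ∣ N) ψ₁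
    * (DirichletCharacter.changeLevel
        (((Dvd.intro_left (4 * N₀) (by ring)).trans (Nat.dvd_lcm_left _ _)).trans hN : N₀ ∣ N)
          ψ₀)⁻¹

/-- `ℓ(n) = (n + 1) ^ (k - 3 / 2) / n ^ (k - 1)` for `n ≠ 0` and `ℓ(0) = 0`, with `r = k - 3 / 2`,
so that `k - 1 = r + 1 / 2`; the power in the denominator is the principal one. -/
def ell (r : ℕ) (n : ℤ) : ℂ :=
  if n = 0 then 0 else ((n : ℂ) + 1) ^ r / (n : ℂ) ^ ((r : ℂ) + 1 / 2)

/-- `f(z) = ∑_{n ≥ -n₀} c_n q ^ n` on the whole upper half-plane. -/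
def HasFourierExpansion (f : ℍ → ℂ) (n₀ : ℤ) (c : ℤ → ℂ) : Prop :=
  (∀ n < -n₀, c n = 0) ∧ ∀ z : ℍ, HasSum (fun n : ℤ => c n * qPow n z) (f z)

end HalfIntegralBol

end

noncomputable section
namespace HalfIntegralBol

open Complex Filter Topology

/-! Write r = k - 3/2. Multiplying f, of weight 1/2 - r, by θ₀, of weight 1/2, gives a form of
integral weight 1 - r. Bol's identity says that D^r carries the weight 1 - r action of SL₂(ℤ) to the
weight 1 + r action, and the quotient θ₀^(-2) θ₁, of weight 1/2, then lifts the result to weight r +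
3/2 = k. Because θ₀ has no zeros, nothing becomes singular on ℍ. The multipliers combine: Kronecker
symbols cancel in pairs, ε_d survives only through ε_d² = (-1/d), and the characters give ψ·ψ₁/ψ₀.
At the cusps it suffices that meromorphy is preserved by products, inverses and D, since Bol's
identity holds for every matrix of SL₂(ℤ) (`isWeaklyHolomorphic_bolOperator`).

Most of the work is the transformation law of θ₀ and θ₁ with its exact multiplier
(`charTheta_smul`). With γz = a/c - 1/(c(cz+d)), the translation by a/c is absorbed into
coefficients periodic modulo c. Poisson summation replaces these by their discrete Fourier transform
(`thetaSum_functional_equation`), and completing the square expresses that transform through one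
quadratic Gauss sum (`dft_twistedChar_even`). Landsberg–Schaar reciprocity together with Dirichlet's
theorem on primes evaluates the Gauss sum (`quadGauss_eq`).

For the coefficients, θ₀ = q + ... and θ₀^(-2) θ₁ = q^(-1) + .... Multiplication by θ₀ therefore
moves c_n to exponent n + 1, D^r multiplies it by (n+1)^r, and the last factor moves it back; all
other contributions to b_n come from c_l with l < n (`exists_bol_coefficients`). -/

/-! ### Theta series with periodic coefficients and their inversion formula. -/

/-- The series `∑ φ(n) n ^ ν exp (π i n² τ)` over all integers `n`. -/
def thetaSum (ν : ℕ) (φ : ℤ → ℂ) (τ : ℂ) : ℂ :=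
  ∑' n : ℤ, φ n * (n : ℂ) ^ ν * cexp (Real.pi * I * (n : ℂ) ^ 2 * τ)

theorem summable_thetaSum_term (ν : ℕ) {φ : ℤ → ℂ} {C : ℝ} (hφ : ∀ n, ‖φ n‖ ≤ C) {τ : ℂ}
    (hτ : 0 < τ.im) :
    Summable fun n : ℤ => φ n * (n : ℂ) ^ ν * cexp (Real.pi * I * (n : ℂ) ^ 2 * τ) := by
  refine Summable.of_norm_bounded
    ((summable_pow_mul_jacobiTheta₂_term_bound 0 hτ ν).mul_left C) fun n => ?_
  have h1 : ‖cexp (Real.pi * I * (n : ℂ) ^ 2 * τ)‖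
      ≤ Real.exp (-Real.pi * (τ.im * n ^ 2 - 2 * 0 * |n|)) := by
    have := norm_jacobiTheta₂_term_le (S := 0) hτ (z := 0) (τ := τ) (by simp) le_rfl n
    simpa [jacobiTheta₂_term] using this
  rw [norm_mul, norm_mul, norm_pow, mul_assoc, norm_intCast]
  have h0 : 0 ≤ C := (norm_nonneg _).trans (hφ 0)
  gcongr
  · exact hφ n
  · exact Int.cast_abs.ge

theorem neg_one_div_im_pos {τ : ℂ} (hτ : 0 < τ.im) : 0 < (-1 / τ).im := by
  have := UpperHalfPlane.im_inv_neg_coe_pos ⟨τ, hτ⟩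
  have h2 : -1 / τ = (-τ)⁻¹ := by rw [neg_div, one_div, inv_neg]
  rw [h2]; exact this

/-- Jacobi's inversion of θ(z, τ) for ν = 0, and of its z-derivative for ν = 1, at z = k/M.
Completing the square turns the transformed series into one over the class of k modulo M. -/
theorem thetaSum_exp_functional_equation {ν : ℕ} (hν : ν ≤ 1) {M : ℕ} (hM : 0 < M) (k : ℤ) {τ : ℂ}
    (hτ : 0 < τ.im) :
    ∑' n : ℤ, (n : ℂ) ^ ν * cexp (2 * Real.pi * I * n * (k / M) + Real.pi * I * (n : ℂ) ^ 2 * τ)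
      = 1 / (-I * τ) ^ (1 / 2 : ℂ) * (-1 / (M * τ)) ^ ν *
        ∑' n : ℤ, ((n * M + k : ℤ) : ℂ) ^ ν *
          cexp (Real.pi * I * ((n * M + k : ℤ) : ℂ) ^ 2 * (-1 / (M ^ 2 * τ))) := by
  have hM0 : (M : ℂ) ≠ 0 := by exact_mod_cast hM.ne'
  have hexp : ∀ n : ℤ, cexp (-Real.pi * I * ((k : ℂ) / M) ^ 2 / τ) *
      cexp (2 * Real.pi * I * ((-n : ℤ) : ℂ) * ((k : ℂ) / M / τ)
        + Real.pi * I * ((-n : ℤ) : ℂ) ^ 2 * (-1 / τ))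
      = cexp (Real.pi * I * ((n * M + k : ℤ) : ℂ) ^ 2 * (-1 / (M ^ 2 * τ))) := by
    intro n
    rw [← Complex.exp_add]
    congr 1
    push_cast
    field_simp
    ring
  have key0 := jacobiTheta₂_functional_equation ((k : ℂ) / M) τ
  interval_cases ν
  · simp only [pow_zero, one_mul, mul_one]
    simp only [jacobiTheta₂, jacobiTheta₂_term] at key0
    rw [key0, mul_assoc, ← (Equiv.neg ℤ).tsum_eq, ← tsum_mul_left]
    congr 1
    refine tsum_congr fun n => ?_
    rw [Equiv.neg_apply, hexp n]
  · have key1 := jacobiTheta₂'_functional_equation ((k : ℂ) / M) τ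
    have hs0 := hasSum_jacobiTheta₂_term ((k : ℂ) / M / τ) (neg_one_div_im_pos hτ)
    have hs1 := hasSum_jacobiTheta₂'_term ((k : ℂ) / M / τ) (neg_one_div_im_pos hτ)
    -- The inversion of θ' involves θ' - 2πi(k/M)θ. Termwise this has the factor n - k/M, which
    -- after n ↦ -n is -(nM + k)/M.
    have hd := (hs1.sub (hs0.mul_left (2 * Real.pi * I * ((k : ℂ) / M)))).tsum_eq
    rw [← hd, jacobiTheta₂', ← (Equiv.neg ℤ).tsum_eq
      (fun n : ℤ => jacobiTheta₂'_term n ((k : ℂ) / M / τ) (-1 / τ) - _)] at key1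
    have hpi : (2 * Real.pi * I : ℂ) ≠ 0 := Complex.two_pi_I_ne_zero
    apply mul_left_cancel₀ hpi
    rw [← tsum_mul_left]
    calc _ = ∑' n : ℤ, jacobiTheta₂'_term n ((k : ℂ) / M) τ := by
          refine tsum_congr fun n => ?_
          simp only [jacobiTheta₂'_term, jacobiTheta₂_term]; ring
      _ = _ := by
          rw [key1, ← tsum_mul_left, ← tsum_mul_left, ← tsum_mul_left]
          refine tsum_congr fun n => ?_
          simp only [jacobiTheta₂'_term, jacobiTheta₂_term, Equiv.neg_apply]
          rw [← hexp n]
          push_cast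
          field_simp
          ring

theorem tsum_eq_sum_residues {M : ℕ} [NeZero M] {g : ℤ → ℂ} (hg : Summable g) :
    ∑' n : ℤ, g n = ∑ k : Fin M, ∑' n : ℤ, g (n * M + (k : ℕ)) := by
  have h1 : Summable fun p : Fin M × ℤ => g (p.2 * M + (p.1 : ℕ)) := by
    have := (((Equiv.prodComm (Fin M) ℤ).trans (Int.divModEquiv M).symm).summable_iff (f := g)).2 hg
    exact this
  rw [← ((Equiv.prodComm (Fin M) ℤ).trans (Int.divModEquiv M).symm).tsum_eq g]
  change ∑' p : Fin M × ℤ, g (p.2 * M + (p.1 : ℕ)) = _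
  rw [h1.tsum_prod, tsum_fintype]

theorem exists_norm_le_of_zmod {M : ℕ} [NeZero M] (φ : ZMod M → ℂ) :
    ∃ C, ∀ n : ZMod M, ‖φ n‖ ≤ C :=
  ⟨∑ n, ‖φ n‖, fun n => Finset.single_le_sum (f := fun n => ‖φ n‖) (fun _ _ => norm_nonneg _)
    (Finset.mem_univ n)⟩

/-- Fourier inversion on ℤ/M writes φ as a combination of the exponentials n ↦ e(kn/M). Each one
inverts to a series over the class of k, and the classes reassemble into a single series. -/
theorem thetaSum_functional_equation {ν : ℕ} (hν : ν ≤ 1) {M : ℕ} [NeZero M] (φ : ZMod M → ℂ)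
    {τ : ℂ} (hτ : 0 < τ.im) :
    thetaSum ν (fun n => φ n) τ = 1 / (M : ℂ) * (1 / (-I * τ) ^ (1 / 2 : ℂ)) *
      (-1 / (M * τ)) ^ ν * thetaSum ν (fun n => ZMod.dft φ n) (-1 / (M ^ 2 * τ)) := by
  have hM : 0 < M := Nat.pos_of_ne_zero (NeZero.ne M)
  have hτ' : 0 < (-1 / ((M : ℂ) ^ 2 * τ)).im := by
    apply neg_one_div_im_pos
    have : ((M : ℂ) ^ 2 * τ) = ((M ^ 2 : ℝ) : ℂ) * τ := by push_cast; rfl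
    rw [this, Complex.im_ofReal_mul]; positivity
  obtain ⟨C, hC⟩ := exists_norm_le_of_zmod (ZMod.dft φ)
  have hinv : ∀ n : ℤ, φ n = 1 / (M : ℂ) *
      ∑ k : Fin M, ZMod.dft φ ((k : ℕ) : ZMod M) * cexp (2 * Real.pi * I * n * (((k : ℕ) : ℤ) / M)) := by
    intro n
    have h1 : φ n = ZMod.dft.symm (ZMod.dft φ) (n : ZMod M) := by simp
    rw [h1, ZMod.invDFT_apply, smul_eq_mul, one_div]
    congr 1
    rw [← Fintype.sum_bijective (fun k : Fin M => ((k : ℕ) : ZMod M)) ?_ _ _ fun k => rfl]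
    · refine Finset.sum_congr rfl fun k _ => ?_
      have := ZMod.stdAddChar_coe (N := M) (((k : ℕ) : ℤ) * n)
      push_cast at this
      rw [this, smul_eq_mul, mul_comm]
      congr 2
      push_cast; ring
    · rw [Fintype.bijective_iff_injective_and_card]
      refine ⟨fun a b hab => ?_, by simp [ZMod.card]⟩
      have := (ZMod.natCast_eq_natCast_iff' _ _ _).1 hab
      rw [Nat.mod_eq_of_lt a.2, Nat.mod_eq_of_lt b.2] at this
      exact Fin.ext this
  have hsum : ∀ k : ℤ, Summable fun n : ℤ =>
      (n : ℂ) ^ ν * cexp (2 * Real.pi * I * n * (k / M) + Real.pi * I * (n : ℂ) ^ 2 * τ) := by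
    intro k
    have := summable_thetaSum_term ν (φ := fun n : ℤ => cexp (2 * Real.pi * I * n * (k / M)))
      (C := 1) (fun n => by
        have : (2 * Real.pi * I * n * (k / M) : ℂ) = ((2 * Real.pi * n * (k / M) : ℝ) : ℂ) * I := by
          push_cast; ring
        rw [this, Complex.norm_exp_ofReal_mul_I]) hτ
    refine this.congr fun n => ?_
    rw [Complex.exp_add]; ring
  have hr : ∑' n : ℤ, ZMod.dft φ n * (n : ℂ) ^ ν *
      cexp (Real.pi * I * (n : ℂ) ^ 2 * (-1 / (M ^ 2 * τ)))
      = ∑ k : Fin M, ZMod.dft φ ((k : ℕ) : ZMod M) * ∑' n : ℤ, ((n * M + (k : ℕ) : ℤ) : ℂ) ^ ν *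
          cexp (Real.pi * I * ((n * M + (k : ℕ) : ℤ) : ℂ) ^ 2 * (-1 / (M ^ 2 * τ))) := by
    rw [tsum_eq_sum_residues (M := M) (summable_thetaSum_term ν (fun n => hC n) hτ')]
    refine Finset.sum_congr rfl fun k _ => ?_
    rw [← tsum_mul_left]
    refine tsum_congr fun n => ?_
    have : ((n * M + (k : ℕ) : ℤ) : ZMod M) = ((k : ℕ) : ZMod M) := by push_cast; simp
    rw [this, mul_assoc]
  rw [thetaSum, thetaSum, hr]
  calc _ = ∑' n : ℤ, ∑ k : Fin M, 1 / (M : ℂ) * ZMod.dft φ ((k : ℕ) : ZMod M) *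
        ((n : ℂ) ^ ν * cexp (2 * Real.pi * I * n * (((k : ℕ) : ℤ) / M)
          + Real.pi * I * (n : ℂ) ^ 2 * τ)) := by
        refine tsum_congr fun n => ?_
        rw [hinv n, Finset.mul_sum, Finset.sum_mul, Finset.sum_mul]
        refine Finset.sum_congr rfl fun k _ => ?_
        rw [Complex.exp_add]; ring
    _ = ∑ k : Fin M, 1 / (M : ℂ) * ZMod.dft φ ((k : ℕ) : ZMod M) *
        ∑' n : ℤ, ((n : ℂ) ^ ν * cexp (2 * Real.pi * I * n * (((k : ℕ) : ℤ) / M)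
          + Real.pi * I * (n : ℂ) ^ 2 * τ)) := by
        rw [Summable.tsum_finsetSum fun k _ => (hsum _).mul_left _]
        refine Finset.sum_congr rfl fun k _ => ?_
        rw [tsum_mul_left]
    _ = _ := by
        rw [Finset.mul_sum]
        refine Finset.sum_congr rfl fun k _ => ?_
        rw [thetaSum_exp_functional_equation hν hM _ hτ]
        ring

/-! ### Theta series as analytic functions of q near q = 0. -/

/-- The power series `∑ φ(n) n ^ ν q ^ (n²)` over all integers `n`. -/
def thetaSeries (ν : ℕ) (φ : ℤ → ℂ) (q : ℂ) : ℂ :=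
  ∑' n : ℤ, φ n * (n : ℂ) ^ ν * q ^ (n.natAbs ^ 2)

theorem natAbs_sq_cast (n : ℤ) : ((n.natAbs ^ 2 : ℕ) : ℂ) = (n : ℂ) ^ 2 := by
  rw [← Int.cast_natCast, Nat.cast_pow, Int.natAbs_sq, Int.cast_pow]

theorem thetaSum_eq_thetaSeries (ν : ℕ) (φ : ℤ → ℂ) (τ : ℂ) :
    thetaSum ν φ τ = thetaSeries ν φ (cexp (Real.pi * I * τ)) := by
  refine tsum_congr fun n => ?_
  rw [← Complex.exp_nat_mul]
  congr 2
  rw [natAbs_sq_cast]; ring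

theorem summable_norm_thetaSeries_term (ν : ℕ) {φ : ℤ → ℂ} {C : ℝ} (hφ : ∀ n, ‖φ n‖ ≤ C) {ρ : ℝ}
    (h0 : 0 < ρ) (h1 : ρ < 1) :
    Summable fun n : ℤ => ‖φ n * (n : ℂ) ^ ν‖ * ρ ^ (n.natAbs ^ 2) := by
  have hlog : Real.log ρ < 0 := Real.log_neg h0 h1
  have hτ : 0 < (((-Real.log ρ / Real.pi : ℝ) : ℂ) * I).im := by
    rw [Complex.mul_I_im, Complex.ofReal_re]
    exact div_pos (by linarith) Real.pi_pos
  refine ((summable_thetaSum_term ν hφ hτ).norm).congr fun n => ?_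
  rw [norm_mul]
  congr 1
  have : (Real.pi * I * (n : ℂ) ^ 2 * (((-Real.log ρ / Real.pi : ℝ) : ℂ) * I))
      = ((((n.natAbs ^ 2 : ℕ) : ℝ) * Real.log ρ : ℝ) : ℂ) := by
    have h' : (((n.natAbs ^ 2 : ℕ) : ℝ) : ℂ) = (n : ℂ) ^ 2 := by
      rw [Complex.ofReal_natCast, natAbs_sq_cast]
    rw [Complex.ofReal_mul, h']
    push_cast
    field_simp
    rw [Complex.I_sq]; ring
  rw [this, Complex.norm_exp_ofReal, Real.exp_nat_mul, Real.exp_log h0]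

theorem thetaSeries_differentiableAt (ν : ℕ) {φ : ℤ → ℂ} {C : ℝ} (hφ : ∀ n, ‖φ n‖ ≤ C) {q : ℂ}
    (hq : ‖q‖ < 1) : DifferentiableAt ℂ (thetaSeries ν φ) q := by
  obtain ⟨ρ, hρ, hρ1⟩ := exists_between hq
  have h0 : 0 < ρ := (norm_nonneg q).trans_lt hρ
  have hd : DifferentiableOn ℂ (thetaSeries ν φ) (Metric.ball 0 ρ) := by
    refine Complex.differentiableOn_tsum_of_summable_norm
      (summable_norm_thetaSeries_term ν hφ h0 hρ1) (fun n => by fun_prop) Metric.isOpen_ball ?_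
    intro n w hw
    rw [norm_mul, norm_pow]
    gcongr
    exact (mem_ball_zero_iff.1 hw).le
  exact hd.differentiableAt (Metric.isOpen_ball.mem_nhds (mem_ball_zero_iff.2 hρ))

theorem thetaSeries_analyticAt_zero (ν : ℕ) {φ : ℤ → ℂ} {C : ℝ} (hφ : ∀ n, ‖φ n‖ ≤ C) :
    AnalyticAt ℂ (thetaSeries ν φ) 0 := by
  rw [Complex.analyticAt_iff_eventually_differentiableAt]
  filter_upwards [Metric.ball_mem_nhds (0 : ℂ) one_pos] with q hq
  exact thetaSeries_differentiableAt ν hφ (mem_ball_zero_iff.1 hq)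

theorem thetaSeries_zero (φ : ℤ → ℂ) : thetaSeries 0 φ 0 = φ 0 := by
  rw [thetaSeries, tsum_eq_single 0]
  · simp
  · intro n hn; simp [hn]

/-- The theta series tends to its constant term as the imaginary part tends to infinity. -/
theorem tendsto_thetaSum {φ : ℤ → ℂ} {C : ℝ} (hφ : ∀ n, ‖φ n‖ ≤ C) {ι : Type*} {l : Filter ι}
    {τ : ι → ℂ} (hτ : Tendsto (fun i => (τ i).im) l atTop) :
    Tendsto (fun i => thetaSum 0 φ (τ i)) l (𝓝 (φ 0)) := by
  have h1 : Tendsto (fun i => cexp (Real.pi * I * τ i)) l (𝓝 0) := by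
    rw [tendsto_zero_iff_norm_tendsto_zero]
    have : ∀ i, ‖cexp (Real.pi * I * τ i)‖ = Real.exp (-(Real.pi * (τ i).im)) := by
      intro i
      rw [Complex.norm_exp]
      congr 1
      simp [mul_assoc]
    simp_rw [this]
    exact Real.tendsto_exp_neg_atTop_nhds_zero.comp (hτ.const_mul_atTop Real.pi_pos)
  have h2 := (thetaSeries_analyticAt_zero 0 hφ).continuousAt.tendsto.comp h1
  rw [thetaSeries_zero] at h2
  refine h2.congr fun i => ?_
  rw [thetaSum_eq_thetaSeries]; rfl

/-! ### Quadratic Gauss sums: reciprocity and evaluation. -/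

theorem ofReal_mul_cpow {r : ℝ} (hr : 0 < r) {x : ℂ} (hx : x ≠ 0) (s : ℂ) :
    ((r : ℂ) * x) ^ s = (r : ℂ) ^ s * x ^ s := by
  have hr' : (r : ℂ) ≠ 0 := by exact_mod_cast hr.ne'
  rw [cpow_def_of_ne_zero (mul_ne_zero hr' hx), cpow_def_of_ne_zero hr', cpow_def_of_ne_zero hx,
    Complex.log_ofReal_mul hr hx, ← Complex.ofReal_log hr.le, add_mul, Complex.exp_add]

theorem sq_cpow_half {x : ℂ} (hx : 0 < x.re) : (x ^ 2) ^ (1 / 2 : ℂ) = x := by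
  have := Complex.sq_cpow_two_inv hx
  rw [one_div]; exact_mod_cast this

/-- The quadratic Gauss sum `∑ exp (2 π i a x² / c)` over the residues `x` modulo `c`. -/
def quadGauss (c : ℕ) [NeZero c] (a : ZMod c) : ℂ := ∑ x : ZMod c, ZMod.stdAddChar (a * x ^ 2)

/-- Near the rational a/M the translation becomes the periodic coefficient e(an²/M). After inversion
the constant term is the transform at 0, that is the Gauss sum, so the asymptotics of θ at a/M
detect it. -/
theorem thetaSum_add_rational {M : ℕ} [NeZero M] (a : ℤ) {ζ : ℂ} (hζ : 0 < ζ.im) :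
    (-2 * I * ζ) ^ (1 / 2 : ℂ) * thetaSum 0 1 (2 * (a / M + ζ)) =
      1 / (M : ℂ) * thetaSum 0 (fun n => ZMod.dft
        (fun x : ZMod M => ZMod.stdAddChar ((a : ZMod M) * x ^ 2)) n) (-1 / (M ^ 2 * (2 * ζ))) := by
  have h2 : 0 < (2 * ζ).im := by simpa using hζ
  have h0 : (-I * (2 * ζ)) ^ (1 / 2 : ℂ) ≠ 0 := by
    have : ζ ≠ 0 := by rintro rfl; simp at hζ
    rw [Ne, cpow_eq_zero_iff]; simp [this]
  have h := thetaSum_functional_equation (ν := 0) (by norm_num)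
    (fun x : ZMod M => ZMod.stdAddChar ((a : ZMod M) * x ^ 2)) h2
  have e : thetaSum 0 1 (2 * (a / M + ζ)) =
      thetaSum 0 (fun n => ZMod.stdAddChar ((a : ZMod M) * (n : ZMod M) ^ 2)) (2 * ζ) := by
    refine tsum_congr fun n => ?_
    have := ZMod.stdAddChar_coe (N := M) (a * n ^ 2)
    push_cast at this
    simp only []
    rw [this, Pi.one_apply, pow_zero, mul_one, one_mul, mul_one, ← Complex.exp_add]
    congr 1; ring
  rw [e, h, pow_zero, mul_one, show -2 * I * ζ = -I * (2 * ζ) by ring]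
  generalize (-I * (2 * ζ)) ^ (1 / 2 : ℂ) = X at h0
  field_simp

theorem dft_quadratic_zero {M : ℕ} [NeZero M] (a : ℤ) :
    ZMod.dft (fun x : ZMod M => ZMod.stdAddChar ((a : ZMod M) * x ^ 2)) ((0 : ℤ) : ZMod M)
      = quadGauss M a := by
  rw [Int.cast_zero, ZMod.dft_apply_zero]; rfl

theorem tendsto_thetaSum_rational {M : ℕ} [NeZero M] (a : ℤ) {ζ : ℝ → ℂ}
    (hζ : ∀ t, 0 < t → 0 < (ζ t).im)
    (hlim : Tendsto (fun t => (-1 / ((M : ℂ) ^ 2 * (2 * ζ t))).im) (𝓝[>] 0) atTop) :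
    Tendsto (fun t => (-2 * I * ζ t) ^ (1 / 2 : ℂ) * thetaSum 0 1 (2 * (a / M + ζ t))) (𝓝[>] 0)
      (𝓝 (1 / (M : ℂ) * quadGauss M a)) := by
  obtain ⟨C, hC⟩ := exists_norm_le_of_zmod (ZMod.dft
        (fun x : ZMod M => ZMod.stdAddChar ((a : ZMod M) * x ^ 2)))
  have h := (tendsto_thetaSum (fun n : ℤ => hC n) hlim).const_mul (1 / (M : ℂ))
  rw [dft_quadratic_zero] at h
  refine h.congr' ?_
  filter_upwards [self_mem_nhdsWithin] with t ht
  rw [thetaSum_add_rational a (hζ t ht)]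

theorem thetaSum_one_inversion {z : ℂ} (hz : 0 < z.im) :
    (-2 * I * z) ^ (1 / 2 : ℂ) * thetaSum 0 1 (2 * z) = thetaSum 0 1 (2 * (-1 / (4 * z))) := by
  have := thetaSum_add_rational (M := 1) 0 hz
  simp only [Int.cast_zero, Nat.cast_one, zero_div, zero_add, one_div, inv_one, one_mul] at this
  rw [one_div, this]
  have h4 : 2 * (-1 / (4 * z)) = -1 / (1 ^ 2 * (2 * z)) := by
    have : z ≠ 0 := by rintro rfl; simp at hz
    field_simp; norm_num
  rw [h4]
  congr 1
  funext n
  rw [ZMod.dft_apply]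
  have : ∀ x : ZMod 1, x = 0 := fun x => Subsingleton.elim _ _
  simp [this]

/-- The Landsberg–Schaar reciprocity law. -/
theorem quadGauss_reciprocity {c₁ p : ℕ} [NeZero (4 * c₁)] [NeZero p] :
    (Real.sqrt p : ℂ) * quadGauss (4 * c₁) (p : ℤ)
      = (1 + I) * Real.sqrt ((4 * c₁ : ℕ) : ℝ) * quadGauss p (-c₁ : ℤ) := by
  set c : ℕ := 4 * c₁ with hc
  have hcpos : 0 < c := Nat.pos_of_ne_zero (NeZero.ne c)
  have hppos : 0 < p := Nat.pos_of_ne_zero (NeZero.ne p)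
  have hcR : (0 : ℝ) < c := by exact_mod_cast hcpos
  have hcC : (c : ℂ) ≠ 0 := by exact_mod_cast hcpos.ne'
  have hpC : (p : ℂ) ≠ 0 := by exact_mod_cast hppos.ne'
  have hcc : (c : ℂ) = 4 * c₁ := by rw [hc]; push_cast; rfl
  -- The point descends vertically to p/c. Since c = 4c₁, its image under z ↦ -1/(4z) tends to
  -- -c₁/p, with displacement `ζ t`.
  set z : ℝ → ℂ := fun t => (p : ℂ) / c + (t : ℂ) * I with hz
  have hzre : ∀ t, (z t).re = p / c := by
    intro t
    have : (p : ℂ) / c = ((p / c : ℝ) : ℂ) := by push_cast; rfl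
    simp only [hz, this]; simp
  have hzim : ∀ t, (z t).im = t := by
    intro t
    have : (p : ℂ) / c = ((p / c : ℝ) : ℂ) := by push_cast; rfl
    simp only [hz, this]; simp
  have hz0 : ∀ t, z t ≠ 0 := by
    intro t h
    have := hzre t
    rw [h] at this
    have h' : (0 : ℝ) < p / c := by positivity
    rw [Complex.zero_re] at this
    linarith
  set ζ : ℝ → ℂ := fun t => (c : ℂ) * I * t / (4 * p * z t) with hζ
  have hζz : ∀ t, -1 / (4 * z t) = (((-c₁ : ℤ) : ℂ) / p + ζ t) := by
    intro t
    have h0 := hz0 t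
    have hzt : z t * c = p + c * I * t := by simp only [hz]; field_simp
    simp only [hζ]
    push_cast
    field_simp
    linear_combination hzt - z t * hcc
  have hinv : ∀ t : ℝ, 0 < t → (-1 / ((p : ℂ) ^ 2 * (2 * ζ t))) = ((2 / (p * c * t) : ℝ) : ℂ) * (I * z t) := by
    intro t ht
    have h0 := hz0 t
    have ht' : (t : ℂ) ≠ 0 := by exact_mod_cast ht.ne'
    simp only [hζ]
    push_cast
    field_simp
    rw [I_sq]
    ring
  have hinvim : ∀ t : ℝ, 0 < t → (-1 / ((p : ℂ) ^ 2 * (2 * ζ t))).im = 2 / c ^ 2 * t⁻¹ := by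
    intro t ht
    rw [hinv t ht, Complex.im_ofReal_mul, Complex.I_mul_im, hzre]
    field_simp
  have hζim : ∀ t, 0 < t → 0 < (ζ t).im := by
    intro t ht
    have h1 : -1 / (4 * z t) = ((4 : ℝ)⁻¹ : ℂ) * (-1 / z t) := by
      have h0 := hz0 t
      push_cast; field_simp
    have h2 : ζ t = ((4⁻¹ : ℝ) : ℂ) * (-1 / z t) - (((-c₁ / p : ℝ)) : ℂ) := by
      have := hζz t
      rw [h1] at this
      push_cast at this ⊢
      linear_combination -this
    rw [h2, Complex.sub_im, Complex.ofReal_im, Complex.im_ofReal_mul, sub_zero]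
    exact mul_pos (by norm_num) (neg_one_div_im_pos (by rw [hzim]; exact ht))
  have hl1 := tendsto_thetaSum_rational (M := c) (p : ℤ) (ζ := fun t => (t : ℂ) * I)
    (fun t ht => by simpa using ht) (by
      have : Tendsto (fun t : ℝ => 1 / (2 * c ^ 2) * t⁻¹ : ℝ → ℝ) (𝓝[>] 0) atTop :=
        tendsto_inv_nhdsGT_zero.const_mul_atTop (by positivity)
      refine this.congr' ?_
      filter_upwards [self_mem_nhdsWithin] with t ht
      have ht' : (t : ℂ) ≠ 0 := by exact_mod_cast (ne_of_gt ht)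
      have e : -1 / ((c : ℂ) ^ 2 * (2 * (t * I))) = ((1 / (2 * c ^ 2) * t⁻¹ : ℝ) : ℂ) * I := by
        push_cast; field_simp; rw [I_sq]
      rw [e, Complex.mul_I_im, Complex.ofReal_re])
  have hl2 := tendsto_thetaSum_rational (M := p) (-c₁ : ℤ) hζim (by
      have : Tendsto (fun t : ℝ => 2 / c ^ 2 * t⁻¹ : ℝ → ℝ) (𝓝[>] 0) atTop :=
        tendsto_inv_nhdsGT_zero.const_mul_atTop (by positivity)
      refine this.congr' ?_
      filter_upwards [self_mem_nhdsWithin] with t ht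
      rw [hinvim t ht])
  have hzlim : Tendsto z (𝓝[>] 0) (𝓝 ((p / c : ℝ) : ℂ)) := by
    have : Continuous z := by fun_prop
    have h := this.tendsto 0
    simp only [hz, Complex.ofReal_zero, zero_mul, add_zero] at h
    push_cast
    exact tendsto_nhdsWithin_of_tendsto_nhds h
  have hpc : (0 : ℝ) < p / c := by positivity
  have hlim1 : Tendsto (fun t => ((c : ℂ) / (4 * p * z t)) ^ (1 / 2 : ℂ)) (𝓝[>] 0)
      (𝓝 ((c : ℂ) / (2 * p))) := by
    have e : (c : ℂ) / (2 * p) = ((c : ℂ) / (4 * p * ((p / c : ℝ) : ℂ))) ^ (1 / 2 : ℂ) := by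
      have h1 : (c : ℂ) / (4 * p * ((p / c : ℝ) : ℂ)) = ((c : ℂ) / (2 * p)) ^ 2 := by
        push_cast; field_simp; norm_num
      have h2 : (c : ℂ) / (2 * p) = ((c / (2 * p) : ℝ) : ℂ) := by push_cast; rfl
      rw [h1, sq_cpow_half]
      rw [h2, Complex.ofReal_re]; positivity
    rw [e]
    have h3 : (c : ℂ) / (4 * p * ((p / c : ℝ) : ℂ)) = ((c / (4 * p * (p / c)) : ℝ) : ℂ) := by
      push_cast; rfl
    refine Tendsto.cpow ?_ tendsto_const_nhds ?_
    · refine tendsto_const_nhds.div (tendsto_const_nhds.mul hzlim) ?_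
      refine mul_ne_zero (mul_ne_zero (by norm_num) hpC) ?_
      exact_mod_cast hpc.ne'
    · rw [h3]; exact Complex.ofReal_mem_slitPlane.2 (by positivity)
  have hlim2 : Tendsto (fun t => (-2 * I * z t) ^ (1 / 2 : ℂ)) (𝓝[>] 0)
      (𝓝 ((Real.sqrt (p / c) : ℂ) * (1 - I))) := by
    have e : (Real.sqrt (p / c) : ℂ) * (1 - I)
        = (-2 * I * ((p / c : ℝ) : ℂ)) ^ (1 / 2 : ℂ) := by
      have h1 : -2 * I * ((p / c : ℝ) : ℂ) = ((Real.sqrt (p / c) : ℂ) * (1 - I)) ^ 2 := by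
        rw [mul_pow, ← Complex.ofReal_pow, Real.sq_sqrt hpc.le, sub_sq, I_sq]; ring
      rw [h1, sq_cpow_half]
      rw [Complex.re_ofReal_mul]
      simpa using Real.sqrt_pos.2 hpc
    rw [e]
    refine Tendsto.cpow (tendsto_const_nhds.mul hzlim) tendsto_const_nhds ?_
    right
    have : -2 * I * ((p / c : ℝ) : ℂ) = ((-2 * (p / c) : ℝ) : ℂ) * I := by push_cast; ring
    rw [this, Complex.mul_I_im, Complex.ofReal_re]
    have := hpc.ne'
    simpa using this
  have hl2' := (hl1.mul hlim1).mul hlim2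
  -- By θ-inversion the asymptotics at -c₁/p and at p/c describe one function; equating the two
  -- limits is the reciprocity law.
  have huniq := tendsto_nhds_unique hl2 (hl2'.congr' (by
    filter_upwards [self_mem_nhdsWithin] with t ht
    have ht0 : 0 < t := ht
    have hz1 := thetaSum_one_inversion (z := z t) (by rw [hzim]; exact ht0)
    rw [hζz t] at hz1
    rw [← hz1]
    have e1 : -2 * I * ζ t = ((2 * t : ℝ) : ℂ) * ((c : ℂ) / (4 * p * z t)) := by
      simp only [hζ]; push_cast
      have := hz0 t
      field_simp; rw [I_sq]; ring
    have e2 : -2 * I * ((t : ℂ) * I) = ((2 * t : ℝ) : ℂ) := by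
      push_cast; linear_combination (-2 * t : ℂ) * I_sq
    have e3 : (c : ℂ) / (4 * p * z t) ≠ 0 :=
      div_ne_zero hcC (mul_ne_zero (mul_ne_zero (by norm_num) hpC) (hz0 t))
    have e4 : (((p : ℕ) : ℤ) : ℂ) / c + t * I = z t := by simp only [hz]; push_cast; rfl
    rw [e1, e2, ofReal_mul_cpow (by positivity) e3, e4]
    ring))
  have hs : (Real.sqrt (p / c) : ℂ) * Real.sqrt c = Real.sqrt p := by
    rw [← Complex.ofReal_mul, ← Real.sqrt_mul hpc.le, div_mul_cancel₀ _ hcR.ne']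
  rw [← hs]
  field_simp at huniq
  change _ * _ * quadGauss c (p : ℤ) = _
  linear_combination (-(1 + I) * Real.sqrt c / 2) * huniq +
    (Real.sqrt (p / c) * Real.sqrt c * quadGauss c (p : ℤ) / 2) * I_sq

/-- For odd p an element y has exactly (y/p) + 1 square roots modulo p. -/
theorem sum_sq_eq_sum_quadraticChar {p : ℕ} [Fact p.Prime] (hp : p ≠ 2) (f : ZMod p → ℂ) :
    ∑ x : ZMod p, f (x ^ 2) = ∑ y : ZMod p, ((quadraticChar (ZMod p) y : ℂ) + 1) * f y := by
  classical
  have hF : ringChar (ZMod p) ≠ 2 := by rwa [ZMod.ringChar_zmod_n]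
  rw [← Finset.sum_fiberwise Finset.univ (fun x : ZMod p => x ^ 2)]
  refine Finset.sum_congr rfl fun y _ => ?_
  rw [Finset.sum_congr rfl (g := fun _ => f y) (fun x hx => by
    rw [(Finset.mem_filter.1 hx).2]), Finset.sum_const, nsmul_eq_mul]
  congr 1
  have h := quadraticChar_card_sqrts hF y
  have h2 : {x : ZMod p | x ^ 2 = y}.toFinset = Finset.univ.filter fun x => x ^ 2 = y := by
    ext; simp
  rw [h2] at h
  exact_mod_cast congrArg (Int.cast : ℤ → ℂ) h

theorem quadGauss_prime {p : ℕ} [Fact p.Prime] (hp : p ≠ 2) {a : ZMod p} (ha : a ≠ 0) :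
    quadGauss p a = (quadraticChar (ZMod p) a : ℂ) * quadGauss p 1 := by
  have key : ∀ b : ZMod p, b ≠ 0 →
      quadGauss p b = ∑ y : ZMod p, (quadraticChar (ZMod p) y : ℂ) * ZMod.stdAddChar (b * y) := by
    intro b hb
    rw [quadGauss, sum_sq_eq_sum_quadraticChar hp fun y => ZMod.stdAddChar (b * y)]
    simp only [add_mul, one_mul, Finset.sum_add_distrib]
    have h0 : ∑ x : ZMod p, ZMod.stdAddChar (b * x) = 0 :=
      AddChar.sum_eq_zero_of_ne_one (ZMod.isPrimitive_stdAddChar p hb)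
    rw [h0, add_zero]
  rw [key a ha, key 1 one_ne_zero, Finset.mul_sum]
  refine Fintype.sum_equiv (Equiv.mulLeft₀ a ha) _ _ fun y => ?_
  have h1 : ((quadraticChar (ZMod p) a : ℤ) : ℂ) ^ 2 = 1 := by
    exact_mod_cast congrArg (Int.cast : ℤ → ℂ) (quadraticChar_sq_one ha)
  simp only [Equiv.mulLeft₀_apply, map_mul, one_mul, Int.cast_mul]
  linear_combination (-(quadraticChar (ZMod p) y : ℂ) * ZMod.stdAddChar (a * y)) * h1

theorem stdAddChar_four_natCast (p : ℕ) : ZMod.stdAddChar (p : ZMod 4) = I ^ p := by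
  have h1 : ZMod.stdAddChar (1 : ZMod 4) = I := by
    have := ZMod.stdAddChar_coe (N := 4) 1
    rw [Int.cast_one] at this
    rw [this, show (2 * Real.pi * I * ((1 : ℤ) : ℂ) / ((4 : ℕ) : ℂ)) = Real.pi / 2 * I by
      push_cast; ring, Complex.exp_pi_div_two_mul_I]
  rw [← h1, ← AddChar.map_nsmul_eq_pow, nsmul_one]

theorem quadGauss_four (p : ℕ) : quadGauss 4 (p : ℤ) = 2 * (1 + I ^ p) := by
  have hu : (Finset.univ : Finset (ZMod 4)) = {0, 1, 2, 3} := by decide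
  have h2 : (2 : ZMod 4) ^ 2 = 0 := by decide
  have h3 : (3 : ZMod 4) ^ 2 = 1 := by decide
  rw [quadGauss, hu, Finset.sum_insert (by decide), Finset.sum_insert (by decide),
    Finset.sum_insert (by decide), Finset.sum_singleton, h2, h3]
  simp [stdAddChar_four_natCast]
  ring

/-- Reciprocity is used for the moduli 4c₁ and 4. The two Gauss sums modulo p on the other side
differ by the factor (c₁/p), and the sum modulo 4 is explicit, so the sign of the Gauss sum modulo p
is never needed. -/
theorem quadGauss_four_mul_prime {c₁ p : ℕ} [NeZero (4 * c₁)] [Fact p.Prime] (hp : p ≠ 2)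
    (hpc : ¬ p ∣ c₁) :
    quadGauss (4 * c₁) (p : ℤ) =
      Real.sqrt ((4 * c₁ : ℕ) : ℝ) * jacobiSym (4 * c₁ : ℕ) p * (1 + I ^ p) := by
  have hpp : p.Prime := Fact.out
  have h1 := quadGauss_reciprocity (c₁ := c₁) (p := p)
  have h2 := quadGauss_reciprocity (c₁ := 1) (p := p)
  have h3 : quadGauss (4 * 1) (p : ℤ) = 2 * (1 + I ^ p) := quadGauss_four p
  rw [h3] at h2
  have h4 : Real.sqrt ((4 * 1 : ℕ) : ℝ) = 2 := by
    rw [show ((4 * 1 : ℕ) : ℝ) = 2 ^ 2 by norm_num]; exact Real.sqrt_sq (by norm_num)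
  rw [h4] at h2
  have hc1 : ((c₁ : ℕ) : ZMod p) ≠ 0 := by rwa [Ne, ZMod.natCast_eq_zero_iff]
  have hodd : Odd p := hpp.odd_of_ne_two hp
  have e1 : quadGauss p ((-c₁ : ℤ) : ZMod p)
      = (jacobiSym (4 * c₁ : ℕ) p : ℂ) * quadGauss p ((-(1 : ℕ) : ℤ) : ZMod p) := by
    have hj : jacobiSym (4 * c₁ : ℕ) p = quadraticChar (ZMod p) (c₁ : ZMod p) := by
      push_cast
      rw [jacobiSym.mul_left, jacobiSym.at_four hodd, one_mul, ← jacobiSym.legendreSym.to_jacobiSym]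
      simp [legendreSym]
    rw [hj]
    push_cast
    rw [quadGauss_prime hp (neg_ne_zero.2 hc1), quadGauss_prime hp (neg_ne_zero.2 one_ne_zero),
      ← neg_one_mul, map_mul]
    push_cast
    ring
  have hsp : (Real.sqrt p : ℂ) ≠ 0 := by
    exact_mod_cast (Real.sqrt_pos.2 (by exact_mod_cast hpp.pos)).ne'
  apply mul_left_cancel₀ hsp
  rw [h1, e1]
  have h2' : (Real.sqrt p : ℂ) * (1 + I ^ p)
      = (1 + I) * quadGauss p ((-(1 : ℕ) : ℤ) : ZMod p) := by
    push_cast at h2 ⊢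
    linear_combination h2 / 2
  linear_combination (-(Real.sqrt ((4 * c₁ : ℕ) : ℝ) : ℂ) * (jacobiSym (4 * c₁ : ℕ) p : ℂ)) * h2'

theorem quadGauss_neg {c : ℕ} [NeZero c] (a : ZMod c) :
    quadGauss c (-a) = (starRingEnd ℂ) (quadGauss c a) := by
  rw [quadGauss, quadGauss, map_sum]
  refine Finset.sum_congr rfl fun x _ => ?_
  rw [neg_mul, ← AddChar.map_neg_eq_conj]

/-- Evaluation of the quadratic Gauss sum whose modulus is divisible by `4`. -/
theorem quadGauss_eq {c : ℕ} [NeZero c] (h4 : 4 ∣ c) {d : ℤ} (hd : IsCoprime (c : ℤ) d) :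
    quadGauss c d * eps d = Real.sqrt c * kroneckerOdd c d * (1 + I) := by
  obtain ⟨c₁, rfl⟩ := h4
  have hc0 : 4 * c₁ ≠ 0 := NeZero.ne _
  have : NeZero (4 * (4 * c₁)) := ⟨by omega⟩
  have hcop : (d.natAbs).Coprime (4 * c₁) := by
    have := Int.isCoprime_iff_gcd_eq_one.1 hd
    rw [Int.gcd_comm] at this
    exact this
  have hdodd : Odd d.natAbs :=
    (Nat.Coprime.coprime_dvd_right (Dvd.intro _ (show 2 * (2 * c₁) = 4 * c₁ by ring)) hcop).odd_of_right
  have hcop' : (d.natAbs).Coprime (4 * (4 * c₁)) := by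
    refine Nat.Coprime.mul_right ?_ hcop
    exact (Nat.coprime_mul_iff_right.1 hcop).1
  -- Dirichlet's theorem replaces |d| by a prime. The congruence is modulo 4c, c being the modulus
  -- of the Gauss sum, because m ↦ (c/m) has period 4c on odd m; p > c excludes p ∣ c₁.
  obtain ⟨p, hpgt, hpp, hpd⟩ := Nat.forall_exists_prime_gt_and_eq_mod
    ((ZMod.isUnit_iff_coprime d.natAbs (4 * (4 * c₁))).2 hcop') (4 * c₁)
  have : Fact p.Prime := ⟨hpp⟩
  have hpmod : p % (4 * (4 * c₁)) = d.natAbs % (4 * (4 * c₁)) :=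
    (ZMod.natCast_eq_natCast_iff' _ _ _).1 hpd
  have hpmod' : (p : ZMod (4 * c₁)) = (d.natAbs : ZMod (4 * c₁)) := by
    rw [ZMod.natCast_eq_natCast_iff]
    exact Nat.ModEq.of_mul_left 4 hpmod
  have hp4 : p % 4 = d.natAbs % 4 :=
    Nat.ModEq.of_mul_right (4 * c₁) hpmod
  have hp2 : p ≠ 2 := by
    have := Nat.odd_iff.1 hdodd
    omega
  have hpc : ¬ p ∣ c₁ := fun h => by
    have := Nat.le_of_dvd (by omega) h
    omega
  have hpodd := hpp.odd_of_ne_two hp2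
  have hG := quadGauss_four_mul_prime (c₁ := c₁) hp2 hpc
  have hJ : jacobiSym (4 * c₁ : ℕ) p = kroneckerOdd (4 * c₁ : ℕ) d := by
    have h1 := jacobiSym.mod_right (4 * c₁ : ℕ) hpodd
    have h2 := jacobiSym.mod_right (4 * c₁ : ℕ) hdodd
    rw [Int.natAbs_natCast] at h1 h2
    rw [h1, hpmod, ← h2, kroneckerOdd, if_neg (by omega), one_mul]
  have hpow : I ^ p = if p % 4 = 1 then I else -I := by
    rw [← Nat.div_add_mod p 4, pow_add, pow_mul, I_pow_four, one_pow, one_mul]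
    have := Nat.odd_iff.1 hpodd
    have : p % 4 = 1 ∨ p % 4 = 3 := by omega
    rcases this with h | h
    · simp [h]
    · simp [h, pow_succ]
  rw [hJ, Int.cast_natCast, hpmod', hpow] at hG
  have hodd' := Nat.odd_iff.1 hdodd
  rcases Int.natAbs_eq d with hd' | hd'
  · have e : (d : ZMod (4 * c₁)) = (d.natAbs : ZMod (4 * c₁)) := by
      conv_lhs => rw [hd']
      simp
    rw [e, hG, eps]
    have : p % 4 = 1 ∨ p % 4 = 3 := by omega
    rcases this with h | h
    · rw [if_pos h, if_pos (by omega)]; ring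
    · rw [if_neg (by omega), if_neg (by omega)]
      linear_combination (-(Real.sqrt ((4 * c₁ : ℕ) : ℝ) : ℂ) *
        (kroneckerOdd (4 * c₁ : ℕ) d : ℂ)) * I_sq
  -- A negative d conjugates the Gauss sum, and the residue of d modulo 4 is swapped with respect to
  -- that of |d|.
  · have e : (d : ZMod (4 * c₁)) = -(d.natAbs : ZMod (4 * c₁)) := by
      conv_lhs => rw [hd']
      simp
    rw [e, quadGauss_neg, hG, eps]
    have : p % 4 = 1 ∨ p % 4 = 3 := by omega
    rcases this with h | h
    · rw [if_pos h, if_neg (by omega)]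
      simp only [map_mul, map_add, map_one, Complex.conj_ofReal, Complex.conj_I, map_intCast]
      linear_combination (-(Real.sqrt ((4 * c₁ : ℕ) : ℝ) : ℂ) *
        (kroneckerOdd (4 * c₁ : ℕ) d : ℂ)) * I_sq
    · rw [if_neg (by omega), if_pos (by omega)]
      simp only [map_mul, map_add, map_one, map_neg, Complex.conj_ofReal, Complex.conj_I, map_intCast]
      ring

/-! ### The theta transformation law under Γ₀(4N²). -/

theorem cpow_half_sq (w : ℂ) : (w ^ (1 / 2 : ℂ)) ^ 2 = w := by
  rw [one_div]; exact_mod_cast Complex.cpow_nat_inv_pow w two_ne_zero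

theorem cpow_half_re_im_pos {w : ℂ} (hw : 0 < w.im) :
    0 < (w ^ (1 / 2 : ℂ)).re ∧ 0 < (w ^ (1 / 2 : ℂ)).im := by
  have h1 : 0 ≤ (w ^ (1 / 2 : ℂ)).re := by
    rw [one_div, Complex.cpow_inv_two_re]; positivity
  have h2 : (w ^ (1 / 2 : ℂ)).re * (w ^ (1 / 2 : ℂ)).im * 2 = w.im := by
    conv_rhs => rw [← cpow_half_sq w, sq, Complex.mul_im]
    ring
  have h3 : 0 < (w ^ (1 / 2 : ℂ)).re :=
    h1.lt_of_ne' fun h => by rw [h] at h2; linarith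
  exact ⟨h3, by by_contra h; nlinarith⟩

/-- The two sides have equal squares. The branches agree because the root of w lies in the open
first quadrant, and multiplying it by 1 - i keeps its real part positive. -/
theorem inv_cpow_half_eq {c : ℕ} (hc : 0 < c) {w : ℂ} (hw : 0 < w.im) :
    1 / (-I * (-2 / (c * w))) ^ (1 / 2 : ℂ) = Real.sqrt c / 2 * (1 - I) * w ^ (1 / 2 : ℂ) := by
  obtain ⟨h1, h2⟩ := cpow_half_re_im_pos hw
  have hsq := cpow_half_sq w
  have hw0 : w ≠ 0 := by rintro rfl; simp at hw
  set v := w ^ (1 / 2 : ℂ)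
  have hcR : (0 : ℝ) < c := by exact_mod_cast hc
  have hcC : (c : ℂ) ≠ 0 := by exact_mod_cast hc.ne'
  have hs2 : (Real.sqrt c : ℂ) ^ 2 = c := by
    rw [← Complex.ofReal_pow, Real.sq_sqrt hcR.le, Complex.ofReal_natCast]
  set X : ℂ := Real.sqrt c / 2 * (1 - I) * v with hX
  have hXre : 0 < X.re := by
    have : X = ((Real.sqrt c / 2 : ℝ) : ℂ) * ((1 - I) * v) := by rw [hX]; push_cast; ring
    rw [this, Complex.re_ofReal_mul]
    refine mul_pos (by positivity) ?_
    simp; linarith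
  have hX0 : X ≠ 0 := by intro h; rw [h] at hXre; simp at hXre
  have hX2 : X ^ 2 = -I * c * w / 2 := by
    rw [hX, mul_pow, mul_pow, div_pow, hs2, hsq, sub_sq, I_sq]; ring
  have e : -I * (-2 / (c * w)) = (X⁻¹) ^ 2 := by
    rw [inv_pow, hX2]
    field_simp
    linear_combination I_sq
  rw [e, sq_cpow_half, one_div, inv_inv]
  rw [Complex.inv_re]
  exact div_pos hXre (Complex.normSq_pos.2 hX0)

/-- Uses γz = a/c - 1/(c(cz+d)): the part a/c is absorbed in φ and the rest is inverted. M is kept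
free, so that M = c serves for the modular transformation and M = cN for arbitrary cusps. -/
theorem thetaSum_moebius {ν : ℕ} (hν : ν ≤ 1) {M : ℕ} [NeZero M] {c : ℕ} (hc : 0 < c)
    {a b d : ℤ} (h : a * d - b * c = 1) {φ : ZMod M → ℂ} {χ : ℤ → ℂ}
    (hφ : ∀ n : ℤ, φ n = χ n * cexp (2 * Real.pi * I * (a * n ^ 2) / c)) (z : ℍ) :
    thetaSum ν χ (2 * ((a * z + b) / (c * z + d))) =
      1 / M * (Real.sqrt c / 2 * (1 - I) * (c * z + d) ^ (1 / 2 : ℂ)) *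
        (c * (c * z + d) / (2 * M)) ^ ν *
        thetaSum ν (fun n => ZMod.dft φ n) (c * (c * z + d) / (2 * M ^ 2)) := by
  have hcR : (0 : ℝ) < c := by exact_mod_cast hc
  have hcC : (c : ℂ) ≠ 0 := by exact_mod_cast hc.ne'
  have hw : 0 < (c * (z : ℂ) + d).im := by
    have : (c * (z : ℂ) + d).im = c * z.im := by simp
    rw [this]; exact mul_pos hcR z.im_pos
  set w : ℂ := c * (z : ℂ) + d with hwdef
  have hw0 : w ≠ 0 := by intro h; rw [h] at hw; simp at hw
  have hτ : 0 < (-2 / (c * w)).im := by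
    have e : -2 / (c * w) = ((2 / c : ℝ) : ℂ) * (-1 / w) := by push_cast; field_simp
    rw [e, Complex.im_ofReal_mul]
    exact mul_pos (by positivity) (neg_one_div_im_pos hw)
  have e1 : thetaSum ν χ (2 * ((a * z + b) / w)) = thetaSum ν (fun n => φ n) (-2 / (c * w)) := by
    refine tsum_congr fun n => ?_
    have hh : (a : ℂ) * d - b * c = 1 := by exact_mod_cast congrArg (Int.cast : ℤ → ℂ) h
    have e : (a * (z : ℂ) + b) / w = a / c - 1 / (c * w) := by
      field_simp
      rw [hwdef]
      linear_combination (-1 : ℂ) * hh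
    simp only []
    have e' : cexp (Real.pi * I * (n : ℂ) ^ 2 * (2 * (a / c - 1 / (c * w)))) =
        cexp (2 * Real.pi * I * (a * n ^ 2) / c) * cexp (Real.pi * I * (n : ℂ) ^ 2 * (-2 / (c * w))) := by
      rw [← Complex.exp_add]; congr 1; ring
    rw [hφ, e, e']
    ring
  rw [e1, thetaSum_functional_equation hν φ hτ, inv_cpow_half_eq hc hw]
  congr 2
  · congr 1
    field_simp
  · field_simp

section Gamma0

variable {N c : ℕ} [NeZero c]

/-- The function `χ(x) exp (2 π i a x² / c)` on the residues modulo `c`. -/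
def twistedChar (h : N ∣ c) (χ : DirichletCharacter ℂ N) (a : ℤ) (x : ZMod c) : ℂ :=
  χ (ZMod.castHom h (ZMod N) x) * ZMod.stdAddChar ((a : ZMod c) * x ^ 2)

/-- Translating x by s = c/2 fixes both x² modulo c and x modulo N, but multiplies the kernel
e(-lx/c) by -1 when l is odd. -/
theorem dft_twistedChar_odd (h4 : 4 * N ^ 2 ∣ c) (h : N ∣ c) (χ : DirichletCharacter ℂ N)
    (a : ℤ) {l : ℤ} (hl : Odd l) : ZMod.dft (twistedChar h χ a) (l : ZMod c) = 0 := by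
  obtain ⟨c', hc⟩ := h4
  have hcpos : c ≠ 0 := NeZero.ne c
  set s : ZMod c := ((2 * N ^ 2 * c' : ℕ) : ZMod c) with hs
  have h2s : 2 * s = 0 := by
    have : 2 * s = ((c : ℕ) : ZMod c) := by
      rw [hs, hc]; push_cast; ring
    rw [this]; simp
  have hs2 : s ^ 2 = 0 := by
    have : s ^ 2 = (N ^ 2 * c' : ℕ) * (2 * s) := by rw [hs]; push_cast; ring
    rw [this, h2s, mul_zero]
  have hcs : ZMod.castHom h (ZMod N) s = 0 := by
    rw [hs, map_natCast]; push_cast; simp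
  have hsl : s * l = s := by
    obtain ⟨k, rfl⟩ := hl
    push_cast; linear_combination (k : ZMod c) * h2s
  have hchar : ZMod.stdAddChar (-s) = (-1 : ℂ) := by
    have e := ZMod.stdAddChar_coe (N := c) (-(2 * N ^ 2 * c' : ℕ))
    have hcC : (c : ℂ) = 4 * N ^ 2 * c' := by exact_mod_cast congrArg (Nat.cast : ℕ → ℂ) hc
    have hc0 : (c : ℂ) ≠ 0 := by exact_mod_cast hcpos
    rw [Int.cast_neg, Int.cast_natCast] at e
    rw [hs, e]
    have : 2 * Real.pi * I * ((-(2 * N ^ 2 * c' : ℕ) : ℤ) : ℂ) / c = -(Real.pi * I) := by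
      rw [div_eq_iff hc0, hcC]; push_cast; ring
    rw [this, Complex.exp_neg, Complex.exp_pi_mul_I]; norm_num
  have key : ZMod.dft (twistedChar h χ a) (l : ZMod c)
      = -ZMod.dft (twistedChar h χ a) (l : ZMod c) := by
    conv_lhs => rw [ZMod.dft_apply]
    rw [ZMod.dft_apply, ← Finset.sum_neg_distrib]
    refine (Fintype.sum_equiv (Equiv.addRight s) _ _ fun x => ?_).symm
    rw [Equiv.coe_addRight, twistedChar, twistedChar, map_add, hcs, add_zero]
    have e1 : -((x + s) * (l : ZMod c)) = -(x * l) + -s := by linear_combination -hsl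
    have e2 : (a : ZMod c) * (x + s) ^ 2 = a * x ^ 2 := by
      linear_combination (a : ZMod c) * hs2 + a * x * h2s
    rw [e1, e2, AddChar.map_add_eq_mul, hchar]
    simp
  exact self_eq_neg.1 key

variable [NeZero N]

theorem stdAddChar_four_mul_mul {c' : ℕ} (hc : c = 4 * N ^ 2 * c') (h : N ∣ c) (x : ZMod c) :
    ZMod.stdAddChar (((4 * N * c' : ℕ) : ZMod c) * x) = ZMod.stdAddChar (ZMod.castHom h (ZMod N) x) := by
  obtain ⟨n, rfl⟩ := ZMod.intCast_surjective x
  have hc0 : (c : ℂ) ≠ 0 := by exact_mod_cast NeZero.ne c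
  have hcC : (c : ℂ) = 4 * N ^ 2 * c' := by exact_mod_cast congrArg (Nat.cast : ℕ → ℂ) hc
  have hc' : (c' : ℂ) ≠ 0 := by rintro h; rw [h, mul_zero] at hcC; exact hc0 hcC
  have e := ZMod.stdAddChar_coe (N := c) ((4 * N * c' : ℕ) * n)
  rw [Int.cast_mul, Int.cast_natCast] at e
  rw [e, map_intCast, ZMod.stdAddChar_coe, hcC]
  congr 1
  push_cast
  field_simp

/-- The translation by s = c/(2N) preserves the fibre and satisfies s² = 0. It multiplies the sum by
e(dρ/N), which is not 1. -/
theorem sum_fiber_stdAddChar_eq_zero (h4 : 4 * N ^ 2 ∣ c) (h : N ∣ c) {d : ZMod c} (hd : IsUnit d)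
    {ρ : ZMod N} (hρ : ρ ≠ 0) :
    ∑ x : ZMod c with ZMod.castHom h (ZMod N) x = ρ, ZMod.stdAddChar (d * x ^ 2) = 0 := by
  obtain ⟨c', hc⟩ := h4
  set s : ZMod c := ((2 * N * c' : ℕ) : ZMod c) with hs
  have hs2 : s ^ 2 = 0 := by
    have : s ^ 2 = ((c * c' : ℕ) : ZMod c) := by
      rw [hs, ← Nat.cast_pow]; congr 1; rw [hc]; ring
    rw [this]; simp
  have hcs : ZMod.castHom h (ZMod N) s = 0 := by
    rw [hs, map_natCast]; push_cast; simp
  have h2s : 2 * s = ((4 * N * c' : ℕ) : ZMod c) := by rw [hs]; push_cast; ring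
  have hk : ZMod.stdAddChar (ZMod.castHom h (ZMod N) d * ρ) ≠ (1 : ℂ) := by
    rw [← (ZMod.stdAddChar (N := N)).map_zero_eq_one, Ne, ZMod.injective_stdAddChar.eq_iff,
      (hd.map _).mul_right_eq_zero]
    exact hρ
  have key : ∑ x : ZMod c with ZMod.castHom h (ZMod N) x = ρ, ZMod.stdAddChar (d * x ^ 2)
      = ZMod.stdAddChar (ZMod.castHom h (ZMod N) d * ρ) *
        ∑ x : ZMod c with ZMod.castHom h (ZMod N) x = ρ, ZMod.stdAddChar (d * x ^ 2) := by
    rw [Finset.mul_sum, Finset.sum_filter, Finset.sum_filter]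
    refine (Fintype.sum_equiv (Equiv.addRight s) _ _ fun x => ?_).symm
    rw [Equiv.coe_addRight, map_add, hcs, add_zero]
    split_ifs with hx
    · have e : d * (x + s) ^ 2 = d * x ^ 2 + ((4 * N * c' : ℕ) : ZMod c) * (d * x) := by
        rw [← h2s]; linear_combination d * hs2
      rw [e, AddChar.map_add_eq_mul, stdAddChar_four_mul_mul hc h, map_mul (ZMod.castHom h (ZMod N)), hx, mul_comm]
    · rfl
  have : (1 - ZMod.stdAddChar (ZMod.castHom h (ZMod N) d * ρ)) *
      ∑ x : ZMod c with ZMod.castHom h (ZMod N) x = ρ, ZMod.stdAddChar (d * x ^ 2) = 0 := by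
    linear_combination key
  exact (mul_eq_zero.1 this).resolve_left (sub_ne_zero.2 (Ne.symm hk))

/-- Only the fibre over 0 contributes. The case F = 1 shows that this fibre already carries the
whole Gauss sum. -/
theorem sum_mul_stdAddChar_sq (h4 : 4 * N ^ 2 ∣ c) (h : N ∣ c) {d : ZMod c} (hd : IsUnit d)
    (F : ZMod N → ℂ) :
    ∑ x : ZMod c, F (ZMod.castHom h (ZMod N) x) * ZMod.stdAddChar (d * x ^ 2)
      = F 0 * quadGauss c d := by
  have key : ∀ F : ZMod N → ℂ,
      ∑ x : ZMod c, F (ZMod.castHom h (ZMod N) x) * ZMod.stdAddChar (d * x ^ 2) =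
      F 0 * ∑ x : ZMod c with ZMod.castHom h (ZMod N) x = 0, ZMod.stdAddChar (d * x ^ 2) := by
    intro F
    rw [← Finset.sum_fiberwise Finset.univ (fun x : ZMod c => ZMod.castHom h (ZMod N) x),
      Finset.sum_eq_single 0]
    · rw [Finset.mul_sum]
      refine Finset.sum_congr rfl fun x hx => ?_
      rw [(Finset.mem_filter.1 hx).2]
    · intro ρ _ hρ
      rw [← mul_zero (F ρ), ← sum_fiber_stdAddChar_eq_zero h4 h hd hρ, Finset.mul_sum]
      refine Finset.sum_congr rfl fun x hx => ?_
      rw [(Finset.mem_filter.1 hx).2]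
    · simp
  rw [key F, quadGauss]
  have := key 1
  simp only [Pi.one_apply, one_mul] at this
  rw [this]

/-- Complete the square: with y = ax - l and ad = 1 one has ax² - 2lx = dy² - dl² and x = d(y + l).
The character factor then depends on y modulo N only and may be evaluated at y = 0. -/
theorem dft_twistedChar_even (h4 : 4 * N ^ 2 ∣ c) (h : N ∣ c) (χ : DirichletCharacter ℂ N)
    {a d : ℤ} (had : (a : ZMod c) * d = 1) (l : ℤ) :
    ZMod.dft (twistedChar h χ a) ((2 * l : ℤ) : ZMod c) * ZMod.stdAddChar ((d * l ^ 2 : ℤ) : ZMod c)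
      = χ d * χ l * quadGauss c d := by
  have hdu : IsUnit (d : ZMod c) := IsUnit.of_mul_eq_one _ ((mul_comm _ _).trans had)
  have hau : IsUnit (a : ZMod c) := IsUnit.of_mul_eq_one _ had
  have := sum_mul_stdAddChar_sq h4 h hdu (fun ρ => χ (d * (ρ + l)))
  rw [zero_add, map_mul] at this
  rw [← this, ZMod.dft_apply, Finset.sum_mul]
  have had' : (a : ZMod N) * d = 1 := by
    have := congrArg (ZMod.castHom h (ZMod N)) had
    rwa [map_mul, map_intCast, map_intCast, map_one] at this
  refine Fintype.sum_equiv (hau.unit.mulLeft.trans (Equiv.addRight (-(l : ZMod c)))) _ _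
    fun x => ?_
  simp only [Equiv.trans_apply, Units.mulLeft_apply, IsUnit.unit_spec, Equiv.coe_addRight]
  have e1 : (d : ZMod N) * (ZMod.castHom h (ZMod N) (a * x + -l) + l) = ZMod.castHom h (ZMod N) x := by
    rw [map_add, map_mul, map_neg, map_intCast, map_intCast]
    linear_combination (ZMod.castHom h (ZMod N) x) * had'
  have e2 : (d : ZMod c) * (a * x + -l) ^ 2 = -(x * (2 * l : ℤ)) + a * x ^ 2 + (d * l ^ 2 : ℤ) := by
    push_cast
    linear_combination (a * x ^ 2 - 2 * l * x) * had
  rw [e1, e2, AddChar.map_add_eq_mul, AddChar.map_add_eq_mul, twistedChar, smul_eq_mul]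
  ring

/-- The transformation of the theta series of a Dirichlet character modulo `N` under a matrix of
`Γ₀(4 N²)` with positive lower left entry. -/
theorem thetaSum_char_transform {ν : ℕ} (hν : ν ≤ 1) (h4 : 4 * N ^ 2 ∣ c)
    (χ : DirichletCharacter ℂ N) {a b d : ℤ} (hdet : a * d - b * c = 1) (z : ℍ) :
    eps d * thetaSum ν (fun n => χ n) (2 * ((a * z + b) / (c * z + d))) =
      kroneckerOdd c d * χ d * (c * z + d) ^ (1 / 2 : ℂ) * (c * z + d) ^ ν *
        thetaSum ν (fun n => χ n) (2 * z) := by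
  have hN : N ∣ c := (Dvd.intro_left (4 * N) (by ring)).trans h4
  have hcpos : 0 < c := Nat.pos_of_ne_zero (NeZero.ne c)
  have hcR : (0 : ℝ) < c := by exact_mod_cast hcpos
  have hcC : (c : ℂ) ≠ 0 := by exact_mod_cast hcpos.ne'
  have had : (a : ZMod c) * d = 1 := by
    have := congrArg (Int.cast : ℤ → ZMod c) hdet
    push_cast at this
    simpa using this
  have hφ : ∀ n : ℤ, twistedChar hN χ a n = χ n * cexp (2 * Real.pi * I * (a * n ^ 2) / c) := by
    intro n
    have := ZMod.stdAddChar_coe (N := c) (a * n ^ 2)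
    push_cast at this
    rw [twistedChar, map_intCast, this]
  rw [thetaSum_moebius hν hcpos hdet hφ z]
  have hG := quadGauss_eq (c := c) ((Dvd.intro _ rfl).trans h4) (d := d)
    ⟨-b, a, by linear_combination hdet⟩
  have hw : (c : ℂ) * (c * (z : ℂ) + d) / (2 * c ^ 2) = (c * z + d) / (2 * c) := by field_simp
  -- Only n = 2l survives, which gives the factor 2^ν. The phase e(-dl²/c) of the transform cancels
  -- the one produced by the translation d/c.
  have hsum : thetaSum ν (fun n => ZMod.dft (twistedChar hN χ a) n) ((c * z + d) / (2 * c)) =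
      χ d * quadGauss c d * 2 ^ ν * thetaSum ν (fun n => χ n) (2 * z) := by
    have hinj : Function.Injective fun l : ℤ => 2 * l := fun x y h => by simpa using h
    rw [thetaSum, ← hinj.tsum_eq, thetaSum, ← tsum_mul_left]
    · refine tsum_congr fun l => ?_
      have h1 := dft_twistedChar_even h4 hN χ had l
      rw [ZMod.stdAddChar_coe] at h1
      have e : cexp (Real.pi * I * ((2 * l : ℤ) : ℂ) ^ 2 * ((c * z + d) / (2 * c)))
          = cexp (2 * Real.pi * I * ((d * l ^ 2 : ℤ) : ℂ) / c) *
            cexp (Real.pi * I * (l : ℂ) ^ 2 * (2 * z)) := by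
        rw [← Complex.exp_add]
        congr 1
        push_cast
        field_simp
        ring
      have e0 : ((2 * l : ℤ) : ℂ) = 2 * l := by push_cast; rfl
      rw [e, e0, mul_pow]
      linear_combination (2 ^ ν * (l : ℂ) ^ ν * cexp (Real.pi * I * (l : ℂ) ^ 2 * (2 * z))) * h1
    · intro l hl
      rw [Function.mem_support] at hl
      rcases Int.even_or_odd' l with ⟨k, rfl | rfl⟩
      · exact ⟨k, rfl⟩
      · exact absurd (by rw [dft_twistedChar_odd h4 hN χ a ⟨k, rfl⟩]; simp) hl
  rw [hw, hsum]
  have hs2 : (Real.sqrt c : ℂ) ^ 2 = c := by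
    rw [← Complex.ofReal_pow, Real.sq_sqrt hcR.le, Complex.ofReal_natCast]
  have e3 : (c : ℂ) * (c * (z : ℂ) + d) / (2 * c) = (c * z + d) / 2 := by field_simp
  rw [e3, div_pow]
  field_simp
  generalize ((c : ℂ) * (z : ℂ) + d) ^ (1 / 2 : ℂ) = X at *
  generalize thetaSum ν (fun n => χ n) (2 * (z : ℂ)) = T at *
  generalize ((c : ℂ) * (z : ℂ) + d) ^ ν = Y at *
  linear_combination ((Real.sqrt c : ℂ) * (1 - I) * X * Y * χ d * T) * hG +
    (kroneckerOdd c d * χ d * X * Y * T * (1 - I ^ 2)) * hs2 -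
      (c * kroneckerOdd c d * χ d * X * Y * T) * I_sq

end Gamma0

/-- The theta series `∑ χ(n) n ^ ν q ^ (n²)` over all integers `n`. -/
def charTheta (ν : ℕ) {N : ℕ} (χ : DirichletCharacter ℂ N) (z : ℍ) : ℂ :=
  thetaSum ν (fun n => χ n) (2 * z)

theorem coe_SL_smul (γ : SL(2, ℤ)) (z : ℍ) :
    ((γ • z : ℍ) : ℂ) = (((γ 0 0 : ℤ) : ℂ) * z + ((γ 0 1 : ℤ) : ℂ)) /
      (((γ 1 0 : ℤ) : ℂ) * z + ((γ 1 1 : ℤ) : ℂ)) := by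
  rw [UpperHalfPlane.coe_specialLinearGroup_apply]
  simp

theorem det_SL (γ : SL(2, ℤ)) : γ 0 0 * γ 1 1 - γ 0 1 * γ 1 0 = 1 := by
  have := γ.det_coe
  rwa [Matrix.det_fin_two] at this

theorem SL_denom_ne_zero (γ : SL(2, ℤ)) (z : ℍ) :
    ((γ 1 0 : ℤ) : ℂ) * (z : ℂ) + ((γ 1 1 : ℤ) : ℂ) ≠ 0 := by
  have := UpperHalfPlane.denom_ne_zero (γ : GL (Fin 2) ℝ) z
  simpa [UpperHalfPlane.denom] using this

theorem norm_dirichlet_le {N : ℕ} (χ : DirichletCharacter ℂ N) (n : ℤ) : ‖χ n‖ ≤ 1 :=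
  χ.norm_le_one _

theorem thetaSum_eq_two_mul_tsum_nat {ν : ℕ} {φ : ℤ → ℂ} {C : ℝ} (hφ : ∀ n, ‖φ n‖ ≤ C)
    (h0 : φ 0 = 0) (hpar : ∀ n, φ (-n) = (-1) ^ ν * φ n) {τ : ℂ} (hτ : 0 < τ.im) :
    thetaSum ν φ τ = 2 * ∑' n : ℕ, φ n * (n : ℂ) ^ ν * cexp (Real.pi * I * (n : ℂ) ^ 2 * τ) := by
  have hs := summable_thetaSum_term ν hφ hτ
  have h1 := (hs.comp_injective Nat.cast_injective).hasSum
  have heq : ∀ n : ℕ, φ (-n : ℤ) * ((-n : ℤ) : ℂ) ^ ν * cexp (Real.pi * I * ((-n : ℤ) : ℂ) ^ 2 * τ)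
      = φ n * (n : ℂ) ^ ν * cexp (Real.pi * I * (n : ℂ) ^ 2 * τ) := by
    intro n
    rw [hpar]
    push_cast
    rw [neg_pow (n : ℂ) ν, neg_sq]
    have : ((-1 : ℂ) ^ ν) * (-1) ^ ν = 1 := by rw [← mul_pow]; norm_num
    linear_combination (φ n * (n : ℂ) ^ ν * cexp (Real.pi * I * (n : ℂ) ^ 2 * τ)) * this
  have h3 := HasSum.of_nat_of_neg (f := fun n : ℤ =>
    φ n * (n : ℂ) ^ ν * cexp (Real.pi * I * (n : ℂ) ^ 2 * τ)) h1
    (h1.congr_fun fun n => by simpa using heq n)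
  rw [h0, zero_mul, zero_mul, sub_zero, ← two_mul] at h3
  exact h3.tsum_eq

/-- The terms n and -n agree by parity; `h0` removes the term n = 0, which has no partner. -/
theorem theta0_eq {N : ℕ} {χ : DirichletCharacter ℂ N} (hχ : χ.Even) (h0 : χ 0 = 0) (z : ℍ) :
    theta0 χ z = 1 / 2 * charTheta 0 χ z := by
  have hz : 0 < (2 * (z : ℂ)).im := by simpa using z.im_pos
  rw [charTheta, thetaSum_eq_two_mul_tsum_nat (C := 1) (norm_dirichlet_le χ) (by simpa using h0)
    (fun n => by push_cast; rw [hχ.eval_neg]; simp) hz, theta0]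
  rw [← mul_assoc, one_div, inv_mul_cancel₀ two_ne_zero, one_mul]
  refine tsum_congr fun n => ?_
  rw [qPow]
  push_cast
  rw [pow_zero, mul_one]
  congr 2; ring

theorem theta1_eq {N : ℕ} {χ : DirichletCharacter ℂ N} (hχ : χ.Odd) (z : ℍ) :
    theta1 χ z = 1 / 2 * charTheta 1 χ z := by
  have hz : 0 < (2 * (z : ℂ)).im := by simpa using z.im_pos
  have h0 : χ 0 = 0 := by
    have := DirichletCharacter.Odd.eval_neg (ψ := χ) 0 hχ
    rw [neg_zero] at this
    exact self_eq_neg.1 this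
  rw [charTheta, thetaSum_eq_two_mul_tsum_nat (C := 1) (norm_dirichlet_le χ) (by simpa using h0)
    (fun n => by push_cast; rw [hχ.eval_neg]; simp) hz, theta1]
  rw [← mul_assoc, one_div, inv_mul_cancel₀ two_ne_zero, one_mul]
  refine tsum_congr fun n => ?_
  rw [qPow]
  push_cast
  rw [pow_one, mul_comm (n : ℂ)]
  congr 2; ring

theorem neg_cpow_of_im_pos {u : ℂ} (hu : 0 < u.im) (s : ℂ) :
    (-u) ^ s = u ^ s * cexp (-(Real.pi * I) * s) := by
  have h0 : u ≠ 0 := by rintro rfl; simp at hu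
  rw [cpow_def_of_ne_zero (neg_ne_zero.2 h0), cpow_def_of_ne_zero h0, ← Complex.exp_add]
  congr 1
  have : Complex.log (-u) = Complex.log u - Real.pi * I := by
    rw [Complex.log, Complex.log, norm_neg, Complex.arg_neg_eq_arg_sub_pi_of_im_pos hu]
    push_cast; ring
  rw [this]; ring

theorem charTheta_periodic (ν : ℕ) {N : ℕ} (χ : DirichletCharacter ℂ N) {z w : ℍ} (b : ℤ)
    (h : (w : ℂ) = z + b) : charTheta ν χ w = charTheta ν χ z := by
  refine tsum_congr fun n => ?_
  rw [h]
  have : (Real.pi * I * (n : ℂ) ^ 2 * (2 * (z + b))) =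
      Real.pi * I * (n : ℂ) ^ 2 * (2 * z) + ((n ^ 2 * b : ℤ) : ℂ) * (2 * Real.pi * I) := by
    push_cast; ring
  rw [this, Complex.exp_periodic.int_mul]

/-- Under γ ↦ -γ the principal root of cz + d changes by a factor ±i; this is the matching change in
the symbol and in ε_d. -/
theorem eps_mul_kroneckerOdd_neg {c d : ℤ} (hc : c < 0) (hd : Odd d) :
    eps d * kroneckerOdd (-c) (-d) = -I * eps (-d) * kroneckerOdd c d := by
  have hdn : Odd d.natAbs := Int.natAbs_odd.2 hd
  have h1 := jacobiSym.neg (-c) hdn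
  rw [neg_neg] at h1
  have hd2 := Int.odd_iff.1 hd
  rw [kroneckerOdd, kroneckerOdd, if_neg (by omega), Int.natAbs_neg, one_mul, h1]
  generalize jacobiSym (-c) d.natAbs = J
  have h4 : d % 4 = 1 ∨ d % 4 = 3 := by omega
  rcases lt_or_gt_of_ne (show d ≠ 0 by rintro rfl; simp at hd2) with h | h
  · rw [if_pos ⟨hc, h⟩]
    rcases h4 with h4 | h4
    · rw [ZMod.χ₄_nat_three_mod_four (by omega), eps, eps, if_pos h4, if_neg (by omega)]
      push_cast
      linear_combination (J : ℂ) * I_sq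
    · rw [ZMod.χ₄_nat_one_mod_four (by omega), eps, eps, if_neg (by omega), if_pos (by omega)]
      push_cast
      ring
  · rw [if_neg (by omega)]
    rcases h4 with h4 | h4
    · rw [ZMod.χ₄_nat_one_mod_four (by omega), eps, eps, if_pos h4, if_neg (by omega)]
      push_cast
      linear_combination (J : ℂ) * I_sq
    · rw [ZMod.χ₄_nat_three_mod_four (by omega), eps, eps, if_neg (by omega), if_pos (by omega)]
      push_cast
      ring

theorem odd_of_det {a b c d : ℤ} (hdet : a * d - b * c = 1) (hc : 4 ∣ c) : Odd d := by
  rw [← Int.not_even_iff_odd]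
  rintro ⟨k, rfl⟩
  obtain ⟨m, rfl⟩ := hc
  have h2 : a * (k + k) - b * (4 * m) = 2 * (a * k - 2 * (b * m)) := by ring
  omega

/-- The transformation of the theta series of a Dirichlet character modulo `N` under
`Γ₀(4 N²)`. -/
theorem charTheta_smul {ν : ℕ} (hν : ν ≤ 1) {N : ℕ} [NeZero N] (χ : DirichletCharacter ℂ N)
    (hχ : χ (-1) = (-1) ^ ν) {γ : SL(2, ℤ)} (hγ : ((4 * N ^ 2 : ℕ) : ℤ) ∣ γ 1 0) (z : ℍ) :
    eps (γ 1 1) * charTheta ν χ (γ • z) =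
      kroneckerOdd (γ 1 0) (γ 1 1) * χ (γ 1 1 : ℤ) *
        (((γ 1 0 : ℤ) : ℂ) * z + ((γ 1 1 : ℤ) : ℂ)) ^ (1 / 2 : ℂ) *
        (((γ 1 0 : ℤ) : ℂ) * z + ((γ 1 1 : ℤ) : ℂ)) ^ ν * charTheta ν χ z := by
  have hpos : ∀ γ : SL(2, ℤ), ((4 * N ^ 2 : ℕ) : ℤ) ∣ γ 1 0 → 0 < γ 1 0 →
    eps (γ 1 1) * charTheta ν χ (γ • z) =
      kroneckerOdd (γ 1 0) (γ 1 1) * χ (γ 1 1 : ℤ) *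
        (((γ 1 0 : ℤ) : ℂ) * z + ((γ 1 1 : ℤ) : ℂ)) ^ (1 / 2 : ℂ) *
        (((γ 1 0 : ℤ) : ℂ) * z + ((γ 1 1 : ℤ) : ℂ)) ^ ν * charTheta ν χ z := by
    intro γ hγ hc
    obtain ⟨c, hc'⟩ := Int.eq_ofNat_of_zero_le hc.le
    have hdet := det_SL γ
    rw [charTheta, coe_SL_smul]
    rw [hc'] at hc hγ hdet ⊢
    have : NeZero c := ⟨by omega⟩
    exact thetaSum_char_transform hν (Int.natCast_dvd_natCast.1 hγ) χ hdet z
  have hdet := det_SL γ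
  have hχneg : ∀ d : ℤ, χ ((-d : ℤ) : ZMod N) = (-1) ^ ν * χ d := by
    intro d
    rw [Int.cast_neg, ← neg_one_mul, map_mul, hχ]
  have hs : (-1 : ℂ) ^ ν * (-1) ^ ν = 1 := by rw [← mul_pow]; norm_num
  -- For c < 0 the matrix -γ acts identically on ℍ and has positive lower left entry; for c = 0 the
  -- action is an integer translation.
  rcases lt_trichotomy (γ 1 0) 0 with hc | hc | hc
  · have h := hpos (-γ) (by simpa using hγ) (by simpa using hc)
    rw [ModularGroup.SL_neg_smul] at h
    have hw : 0 < (-(((γ 1 0 : ℤ) : ℂ) * (z : ℂ) + ((γ 1 1 : ℤ) : ℂ))).im := by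
      have : (-(((γ 1 0 : ℤ) : ℂ) * (z : ℂ) + ((γ 1 1 : ℤ) : ℂ))).im = -((γ 1 0 : ℤ) : ℝ) * z.im := by
        simp
      rw [this]
      exact mul_pos (by simpa using hc) z.im_pos
    have hodd : Odd (γ 1 1) :=
      odd_of_det hdet ((Int.natCast_dvd_natCast.2 (Dvd.intro _ rfl)).trans hγ)
    have hk := eps_mul_kroneckerOdd_neg hc hodd
    have hroot := neg_cpow_of_im_pos hw (1 / 2)
    rw [neg_neg, show -(Real.pi * I) * (1 / 2 : ℂ) = -(Real.pi / 2 * I) by ring, Complex.exp_neg,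
      Complex.exp_pi_div_two_mul_I, Complex.inv_I] at hroot
    have hm : (-γ : SL(2, ℤ)) 1 0 = -(γ 1 0) ∧ (-γ : SL(2, ℤ)) 1 1 = -(γ 1 1) := by simp
    rw [hm.1, hm.2, hχneg] at h
    have hw' : ((-(γ 1 0) : ℤ) : ℂ) * (z : ℂ) + ((-(γ 1 1) : ℤ) : ℂ)
      = -(((γ 1 0 : ℤ) : ℂ) * (z : ℂ) + ((γ 1 1 : ℤ) : ℂ)) := by push_cast; ring
    rw [hw'] at h
    generalize ((γ 1 0 : ℤ) : ℂ) * (z : ℂ) + ((γ 1 1 : ℤ) : ℂ) = w at h hroot ⊢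
    rw [hroot]
    rw [neg_pow w] at h
    have heps : eps (-(γ 1 1)) ≠ 0 := by rw [eps]; split_ifs <;> simp
    apply mul_left_cancel₀ heps
    generalize charTheta ν χ (γ • z) = A at *
    generalize charTheta ν χ z = B at *
    generalize (-w) ^ (1 / 2 : ℂ) = V at *
    linear_combination (eps (γ 1 1)) * h + (eps (γ 1 1) * kroneckerOdd (-(γ 1 0)) (-(γ 1 1)) *
      χ (γ 1 1 : ℤ) * V * w ^ ν * B) * hs + (χ (γ 1 1 : ℤ) * V * w ^ ν * B) * hk
  · have ha : γ 0 0 * γ 1 1 = 1 := by rw [hc] at hdet; linarith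
    have hsm := coe_SL_smul γ z
    rw [hc] at hsm ⊢
    rcases Int.eq_one_or_neg_one_of_mul_eq_one' ha with ⟨h1, h2⟩ | ⟨h1, h2⟩
    · rw [h1, h2] at hsm
      rw [charTheta_periodic ν χ (z := z) (w := γ • z) (γ 0 1) (by rw [hsm]; push_cast; ring), h2]
      simp [eps, kroneckerOdd]
    · rw [h1, h2] at hsm
      rw [charTheta_periodic ν χ (z := z) (w := γ • z) (-γ 0 1) (by rw [hsm]; push_cast; ring), h2]
      have h12 : (-1 : ℂ) ^ (1 / 2 : ℂ) = I := by
        rw [cpow_def_of_ne_zero (by norm_num), Complex.log_neg_one,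
          show (Real.pi * I * (1 / 2) : ℂ) = Real.pi / 2 * I by ring, Complex.exp_pi_div_two_mul_I]
      have : eps (-1) = I := by rw [eps, if_neg (by norm_num)]
      rw [this]
      simp only [kroneckerOdd, Int.natAbs_neg, Int.natAbs_one, jacobiSym.one_right, Int.cast_neg,
        Int.cast_one, Int.cast_zero, zero_mul, zero_add, hχ, h12]
      rw [if_neg (by omega)]
      push_cast
      linear_combination (-I * charTheta ν χ z) * hs
  · exact hpos γ hγ hc

/-! ### Slash operators, the derivation D and Bol's identity. -/

open scoped ModularForm
open Derivative (normalizedDerivOfComplex)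

theorem preSlash_mul (κ₁ κ₂ : ℤ) (f g : ℍ → ℂ) (γ : SL(2, ℤ)) :
    preSlash (κ₁ + κ₂) (f * g) γ = preSlash κ₁ f γ * preSlash κ₂ g γ := by
  funext z
  have : (-((κ₁ + κ₂ : ℤ) : ℂ) / 2) = -(κ₁ : ℂ) / 2 + -(κ₂ : ℂ) / 2 := by push_cast; ring
  simp only [preSlash, Pi.mul_apply]
  rw [this, cpow_add _ _ (SL_denom_ne_zero γ z)]
  ring

theorem preSlash_inv (κ : ℤ) (f : ℍ → ℂ) (γ : SL(2, ℤ)) :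
    preSlash (-κ) f⁻¹ γ = (preSlash κ f γ)⁻¹ := by
  funext z
  have : (-((-κ : ℤ) : ℂ) / 2) = -(-(κ : ℂ) / 2) := by push_cast; ring
  simp only [preSlash, Pi.inv_apply]
  rw [this, cpow_neg, mul_inv]

/-- For integral weight no branch enters, and Bol's identity becomes applicable. -/
theorem preSlash_two_mul (k : ℤ) (f : ℍ → ℂ) (γ : SL(2, ℤ)) :
    preSlash (2 * k) f γ = f ∣[k] γ := by
  funext z
  have : (-((2 * k : ℤ) : ℂ) / 2) = ((-k : ℤ) : ℂ) := by push_cast; ring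
  rw [preSlash, this, cpow_intCast, ModularForm.SL_slash_apply, mul_comm]
  rfl

theorem MeromorphicAtInfty.mul {f g : ℍ → ℂ} (hf : MeromorphicAtInfty f)
    (hg : MeromorphicAtInfty g) : MeromorphicAtInfty (f * g) := by
  obtain ⟨a, ha, F, hF, hfF⟩ := hf
  obtain ⟨b, hb, G, hG, hgG⟩ := hg
  refine ⟨a * b, Nat.mul_pos ha hb, fun q => F (q ^ b) * G (q ^ a),
    (meromorphicAt_comp_pow hF hb).mul (meromorphicAt_comp_pow hG ha), ?_⟩
  filter_upwards [hfF, hgG] with z h1 h2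
  have e2 : Function.Periodic.qParam ((a * b : ℕ) : ℝ) (z : ℂ) ^ a
      = Function.Periodic.qParam (b : ℝ) (z : ℂ) := by
    rw [mul_comm a b]; exact qParam_mul_pow b a ha z
  simp only [Pi.mul_apply, h1, h2, qParam_mul_pow a b hb, e2]

theorem MeromorphicAtInfty.inv {f : ℍ → ℂ} (hf : MeromorphicAtInfty f) :
    MeromorphicAtInfty f⁻¹ := by
  obtain ⟨a, ha, F, hF, hfF⟩ := hf
  refine ⟨a, ha, F⁻¹, hF.inv, ?_⟩
  filter_upwards [hfF] with z h1
  simp [h1]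

/-- In the coordinate q_h the operator D is h^(-1) q_h d/dq_h, which preserves meromorphy at 0. -/
theorem MeromorphicAtInfty.normalizedDeriv {f : ℍ → ℂ} (hf : MeromorphicAtInfty f) :
    MeromorphicAtInfty (normalizedDerivOfComplex f) := by
  obtain ⟨h, hh, F, hF, hfF⟩ := hf
  have hh' : (0 : ℝ) < h := by exact_mod_cast hh
  refine ⟨h, hh, fun q => (h : ℂ)⁻¹ * (q * deriv F q),
    (MeromorphicAt.const _ 0).mul ((MeromorphicAt.id 0).mul hF.deriv), ?_⟩
  have hq : Tendsto (fun z : ℍ => Function.Periodic.qParam h (z : ℂ)) UpperHalfPlane.atImInfty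
      (𝓝[≠] 0) :=
    tendsto_nhdsWithin_iff.2 ⟨UpperHalfPlane.qParam_tendsto_atImInfty hh',
      Eventually.of_forall fun z => Function.Periodic.qParam_ne_zero _⟩
  obtain ⟨B, hB⟩ := (UpperHalfPlane.atImInfty_mem _).1 hfF
  have hlarge : ∀ᶠ z : ℍ in UpperHalfPlane.atImInfty, B < z.im :=
    (UpperHalfPlane.atImInfty_mem _).2 ⟨B + 1, fun z hz => by
      change B < z.im; linarith⟩
  filter_upwards [hq.eventually hF.eventually_analyticAt, hlarge] with z hz hzB
  have hcongr : f ∘ UpperHalfPlane.ofComplex =ᶠ[𝓝 (z : ℂ)]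
      fun w => F (Function.Periodic.qParam h w) := by
    have h1 : ∀ᶠ w in 𝓝 (z : ℂ), B < w.im :=
      (Complex.continuous_im.continuousAt (x := (z : ℂ))).eventually (lt_mem_nhds hzB)
    filter_upwards [h1, UpperHalfPlane.isOpen_upperHalfPlaneSet.mem_nhds z.im_pos] with w hw hw0
    rw [Function.comp_apply, UpperHalfPlane.ofComplex_apply_of_im_pos hw0]
    exact hB ⟨w, hw0⟩ hw.le
  have hqd : HasDerivAt (Function.Periodic.qParam h)
      (Function.Periodic.qParam h z * (2 * Real.pi * I / h)) (z : ℂ) := by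
    have h1 : HasDerivAt (fun w : ℂ => 2 * Real.pi * I * w / h) (2 * Real.pi * I / h) (z : ℂ) := by
      simpa using ((hasDerivAt_id (z : ℂ)).const_mul (2 * Real.pi * I)).div_const (h : ℂ)
    have h2 := h1.cexp
    rw [← Complex.ofReal_natCast] at h2 ⊢
    exact h2
  have hd := (hz.differentiableAt.hasDerivAt.comp (z : ℂ) hqd).deriv
  rw [Derivative.normalizedDerivOfComplex, hcongr.deriv_eq]
  change (2 * Real.pi * I)⁻¹ * deriv (F ∘ Function.Periodic.qParam h) z = _
  rw [hd]
  have := Complex.two_pi_I_ne_zero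
  field_simp

theorem MeromorphicAtInfty.iterate_normalizedDeriv {f : ℍ → ℂ} (hf : MeromorphicAtInfty f)
    (n : ℕ) : MeromorphicAtInfty (normalizedDerivOfComplex^[n] f) := by
  induction n with
  | zero => exact hf
  | succ n ih => rw [Function.iterate_succ_apply']; exact ih.normalizedDeriv

theorem mdifferentiable_iterate_normalizedDeriv {f : ℍ → ℂ} (hf : MDifferentiable 𝓘(ℂ) 𝓘(ℂ) f)
    (n : ℕ) : MDifferentiable 𝓘(ℂ) 𝓘(ℂ) (normalizedDerivOfComplex^[n] f) := by
  induction n with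
  | zero => exact hf
  | succ n ih =>
    rw [Function.iterate_succ_apply']; exact Derivative.normalizedDerivOfComplex_mdifferentiable ih

theorem normalizedDeriv_denom (γ : SL(2, ℤ)) :
    normalizedDerivOfComplex (fun z : ℍ => UpperHalfPlane.denom γ z) =
      fun _ => (2 * Real.pi * I)⁻¹ * ((γ 1 0 : ℤ) : ℂ) := by
  funext z
  have h1 : HasDerivAt (fun w : ℂ => ((γ 1 0 : ℤ) : ℂ) * w + ((γ 1 1 : ℤ) : ℂ)) ((γ 1 0 : ℤ) : ℂ)
      (z : ℂ) := by
    simpa using ((hasDerivAt_id (z : ℂ)).const_mul ((γ 1 0 : ℤ) : ℂ)).add_const ((γ 1 1 : ℤ) : ℂ)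
  rw [Derivative.normalizedDerivOfComplex, ← h1.deriv]
  congr 1
  apply Filter.EventuallyEq.deriv_eq
  filter_upwards [UpperHalfPlane.isOpen_upperHalfPlaneSet.mem_nhds z.im_pos] with w hw
  rw [Function.comp_apply, UpperHalfPlane.ofComplex_apply_of_im_pos hw]
  simp [UpperHalfPlane.denom]

/-- Leibniz's rule stops after two terms because cz + d is linear in z. -/
theorem iterate_normalizedDeriv_denom_mul (γ : SL(2, ℤ)) {u : ℍ → ℂ}
    (hu : MDifferentiable 𝓘(ℂ) 𝓘(ℂ) u) (n : ℕ) (z : ℍ) :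
    (normalizedDerivOfComplex^[n + 1] ((fun z : ℍ => UpperHalfPlane.denom γ z) * u)) z =
      UpperHalfPlane.denom γ z * (normalizedDerivOfComplex^[n + 1] u) z +
        (n + 1) * ((2 * Real.pi * I)⁻¹ * ((γ 1 0 : ℤ) : ℂ)) * (normalizedDerivOfComplex^[n] u) z := by
  have hj := UpperHalfPlane.mdifferentiable_denom (γ : GL (Fin 2) ℝ)
  induction n generalizing z with
  | zero =>
    simp only [zero_add, Function.iterate_one, Function.iterate_zero, id]
    rw [Derivative.normalizedDerivOfComplex_mul _ _ hj hu, normalizedDeriv_denom]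
    simp only [Pi.add_apply, Pi.mul_apply]
    push_cast; ring
  | succ n ih =>
    have hfun : normalizedDerivOfComplex^[n + 1] ((fun z : ℍ => UpperHalfPlane.denom γ z) * u) =
        (fun z : ℍ => UpperHalfPlane.denom γ z) * normalizedDerivOfComplex^[n + 1] u +
        ((n + 1) * ((2 * Real.pi * I)⁻¹ * ((γ 1 0 : ℤ) : ℂ)) : ℂ) • normalizedDerivOfComplex^[n] u := by
      funext z; exact ih z
    have h1 := mdifferentiable_iterate_normalizedDeriv hu (n + 1)
    have h0 := mdifferentiable_iterate_normalizedDeriv hu n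
    rw [Function.iterate_succ_apply', hfun,
      Derivative.normalizedDerivOfComplex_add _ _ (hj.mul h1) (h0.const_smul _),
      Derivative.normalizedDerivOfComplex_mul _ _ hj h1,
      Derivative.normalizedDerivOfComplex_smul _ _ h0, normalizedDeriv_denom,
      ← Function.iterate_succ_apply' normalizedDerivOfComplex, ← Function.iterate_succ_apply' normalizedDerivOfComplex]
    simp only [Pi.add_apply, Pi.mul_apply, Pi.smul_apply, smul_eq_mul]
    push_cast; ring

/-- **Bol's identity.** -/
theorem iterate_normalizedDeriv_slash (γ : SL(2, ℤ)) {h : ℍ → ℂ}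
    (hh : MDifferentiable 𝓘(ℂ) 𝓘(ℂ) h) (r : ℕ) :
    normalizedDerivOfComplex^[r] (h ∣[1 - (r : ℤ)] γ) =
      (normalizedDerivOfComplex^[r] h) ∣[1 + (r : ℤ)] γ := by
  induction r with
  | zero => simp
  | succ r ih =>
    have hu : MDifferentiable 𝓘(ℂ) 𝓘(ℂ) (h ∣[1 - (r : ℤ)] γ) := hh.slash _ _
    have e : h ∣[1 - ((r + 1 : ℕ) : ℤ)] γ =
        (fun z : ℍ => UpperHalfPlane.denom γ z) * (h ∣[1 - (r : ℤ)] γ) := by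
      funext z
      rw [Pi.mul_apply, ModularForm.SL_slash_apply, ModularForm.SL_slash_apply,
        show -(1 - ((r + 1 : ℕ) : ℤ)) = 1 + -(1 - (r : ℤ)) by push_cast; ring,
        zpow_add₀ (UpperHalfPlane.denom_ne_zero _ z), zpow_one]
      ring
    funext z
    have hd := UpperHalfPlane.denom_ne_zero (γ : GL (Fin 2) ℝ) z
    -- Differentiating a slash of weight 1 + r produces a correction term with factor -(1 +
    -- r)c/(2πi(cz + d)). It cancels exactly the second Leibniz term.
    rw [e, iterate_normalizedDeriv_denom_mul γ hu r z, Function.iterate_succ_apply', ih,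
      Derivative.normalizedDerivOfComplex_SL_slash (mdifferentiable_iterate_normalizedDeriv hh r),
      ← Function.iterate_succ_apply' normalizedDerivOfComplex]
    simp only [Pi.sub_apply]
    rw [ModularForm.SL_slash_apply, ModularForm.SL_slash_apply, ModularForm.SL_slash_apply]
    rw [show -(1 + ((r + 1 : ℕ) : ℤ)) = 1 + -(1 + (r : ℤ) + 2) by push_cast; ring,
      zpow_add₀ hd 1, zpow_one]
    simp
    field_simp
    ring

/-! ### Meromorphy of the theta series at every cusp. -/

section Cusps

variable {N : ℕ} [NeZero N]

/-- Here N need not divide c, so the coefficients have period cN. Their transform need not be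
evaluated: after inversion the series is analytic in a root of q. -/
theorem preSlash_charTheta_of_pos {ν : ℕ} (hν : ν ≤ 1) (χ : DirichletCharacter ℂ N) {γ : SL(2, ℤ)}
    (hγ : 0 < γ 1 0) : MeromorphicAtInfty (preSlash (1 + 2 * ν) (charTheta ν χ) γ) := by
  obtain ⟨c, hc'⟩ := Int.eq_ofNat_of_zero_le hγ.le
  have hcpos : 0 < c := by omega
  have : NeZero c := ⟨by omega⟩
  have : NeZero (c * N) := ⟨mul_ne_zero (NeZero.ne c) (NeZero.ne N)⟩
  have hcC : (c : ℂ) ≠ 0 := by exact_mod_cast NeZero.ne c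
  have hdet := det_SL γ
  rw [hc'] at hdet
  set φ : ZMod (c * N) → ℂ := fun x => χ (ZMod.castHom (dvd_mul_left N c) (ZMod N) x) *
    ZMod.stdAddChar (((γ 0 0 : ℤ) : ZMod c) * (ZMod.castHom (dvd_mul_right c N) (ZMod c) x) ^ 2) with hφdef
  have hφ : ∀ n : ℤ, φ n = χ n * cexp (2 * Real.pi * I * ((γ 0 0 : ℤ) * n ^ 2) / c) := by
    intro n
    have := ZMod.stdAddChar_coe (N := c) ((γ 0 0) * n ^ 2)
    push_cast at this
    rw [hφdef]
    simp only [map_intCast]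
    rw [this]
  obtain ⟨C, hC⟩ := exists_norm_le_of_zmod (ZMod.dft φ)
  have han := thetaSeries_analyticAt_zero ν (φ := fun n => ZMod.dft φ n) (fun n => hC n)
  set ζ : ℂ := cexp (Real.pi * I * (γ 1 1 : ℤ) / (2 * c * N ^ 2)) with hζ
  set K : ℂ := 1 / (c * N : ℕ) * (Real.sqrt c / 2 * (1 - I)) * (1 / (2 * N)) ^ ν with hK
  -- The argument c(cz + d)/(2(cN)²) equals z/(2N²) plus a constant. This gives the width 4N², and
  -- the constant becomes `ζ`.
  refine ⟨4 * N ^ 2, by have := NeZero.pos N; positivity, fun q => K * thetaSeries ν (fun n => ZMod.dft φ n) (ζ * q), ?_, ?_⟩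
  · have h0 : AnalyticAt ℂ (thetaSeries ν (fun n => ZMod.dft φ n)) ((fun q => ζ * q) 0) := by
      simpa using han
    exact (MeromorphicAt.const _ 0).mul
      (h0.comp (f := fun q => ζ * q) (by fun_prop)).meromorphicAt
  · refine Eventually.of_forall fun z => ?_
    have hm := thetaSum_moebius hν hcpos hdet hφ z
    have hw := SL_denom_ne_zero γ z
    rw [preSlash, charTheta, coe_SL_smul]
    rw [hc'] at hw ⊢
    rw [Int.cast_natCast] at hw ⊢
    rw [hm, thetaSum_eq_thetaSeries]
    have e1 : cexp (Real.pi * I * (c * (c * (z : ℂ) + (γ 1 1 : ℤ)) / (2 * ((c * N : ℕ) : ℂ) ^ 2))) =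
        ζ * Function.Periodic.qParam ((4 * N ^ 2 : ℕ) : ℝ) z := by
      rw [hζ, Function.Periodic.qParam, ← Complex.exp_add]
      congr 1
      push_cast
      field_simp
      ring
    have e2 : (c * (z : ℂ) + (γ 1 1 : ℤ)) ^ (-((1 + 2 * ν : ℤ) : ℂ) / 2) *
        (c * (z : ℂ) + (γ 1 1 : ℤ)) ^ (1 / 2 : ℂ) * (c * (z : ℂ) + (γ 1 1 : ℤ)) ^ ν = 1 := by
      rw [← cpow_natCast, ← cpow_add _ _ hw, ← cpow_add _ _ hw]
      rw [show (-((1 + 2 * ν : ℤ) : ℂ) / 2 + 1 / 2 + (ν : ℂ)) = 0 by push_cast; ring, cpow_zero]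
    have e3 : (c : ℂ) * (c * (z : ℂ) + (γ 1 1 : ℤ)) / (2 * (c * N : ℕ)) =
        1 / (2 * N) * (c * (z : ℂ) + (γ 1 1 : ℤ)) := by
      push_cast; field_simp
    rw [e1, e3, mul_pow, hK]
    linear_combination (1 / (c * N : ℕ) * (Real.sqrt c / 2 * (1 - I)) * (1 / (2 * N)) ^ ν *
      thetaSeries ν (fun n => ZMod.dft φ n) (ζ * Function.Periodic.qParam ((4 * N ^ 2 : ℕ) : ℝ) z)) * e2

theorem preSlash_neg_of_neg (κ : ℤ) (f : ℍ → ℂ) {γ : SL(2, ℤ)} (hγ : γ 1 0 < 0) :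
    preSlash κ f γ = cexp (-(Real.pi * I) * (-(κ : ℂ) / 2)) • preSlash κ f (-γ) := by
  funext z
  have hm : (-γ : SL(2, ℤ)) 1 0 = -(γ 1 0) ∧ (-γ : SL(2, ℤ)) 1 1 = -(γ 1 1) := by simp
  have hw : 0 < (((-(γ 1 0) : ℤ) : ℂ) * (z : ℂ) + ((-(γ 1 1) : ℤ) : ℂ)).im := by
    have : (((-(γ 1 0) : ℤ) : ℂ) * (z : ℂ) + ((-(γ 1 1) : ℤ) : ℂ)).im = -((γ 1 0 : ℤ) : ℝ) * z.im := by
      simp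
    rw [this]
    exact mul_pos (by simpa using hγ) z.im_pos
  have h := neg_cpow_of_im_pos hw (-(κ : ℂ) / 2)
  rw [Pi.smul_apply, smul_eq_mul, preSlash, preSlash, hm.1, hm.2, ModularGroup.SL_neg_smul]
  have e : -(((-(γ 1 0) : ℤ) : ℂ) * (z : ℂ) + ((-(γ 1 1) : ℤ) : ℂ)) =
    ((γ 1 0 : ℤ) : ℂ) * (z : ℂ) + ((γ 1 1 : ℤ) : ℂ) := by push_cast; ring
  rw [e] at h
  rw [h]; ring

theorem meromorphicAtInfty_preSlash_charTheta {ν : ℕ} (hν : ν ≤ 1) (χ : DirichletCharacter ℂ N)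
    (γ : SL(2, ℤ)) : MeromorphicAtInfty (preSlash (1 + 2 * ν) (charTheta ν χ) γ) := by
  rcases lt_trichotomy (γ 1 0) 0 with hc | hc | hc
  · rw [preSlash_neg_of_neg _ _ hc]
    exact (preSlash_charTheta_of_pos hν χ (by simpa using hc)).smul _
  · have hdet := det_SL γ
    have ha : γ 0 0 * γ 1 1 = 1 := by rw [hc] at hdet; linarith
    have hper : ∀ z : ℍ, charTheta ν χ (γ • z) = charTheta ν χ z := by
      intro z
      have hsm := coe_SL_smul γ z
      rw [hc] at hsm
      rcases Int.eq_one_or_neg_one_of_mul_eq_one' ha with ⟨h1, h2⟩ | ⟨h1, h2⟩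
      · rw [h1, h2] at hsm
        exact charTheta_periodic ν χ (z := z) (w := γ • z) (γ 0 1) (by rw [hsm]; push_cast; ring)
      · rw [h1, h2] at hsm
        exact charTheta_periodic ν χ (z := z) (w := γ • z) (-γ 0 1) (by rw [hsm]; push_cast; ring)
    have e : preSlash (1 + 2 * ν) (charTheta ν χ) γ =
        (((γ 1 1 : ℤ) : ℂ) ^ (-((1 + 2 * ν : ℤ) : ℂ) / 2)) • charTheta ν χ := by
      funext z
      rw [preSlash, hper, hc]
      simp
    rw [e]
    refine MeromorphicAtInfty.smul _ ⟨1, one_pos, thetaSeries ν (fun n => χ n),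
      (thetaSeries_analyticAt_zero ν (norm_dirichlet_le χ)).meromorphicAt, Eventually.of_forall fun z => ?_⟩
    rw [charTheta, thetaSum_eq_thetaSeries, Function.Periodic.qParam]
    congr 2
    push_cast; ring
  · exact preSlash_charTheta_of_pos hν χ hc

end Cusps

/-! ### The bound for ℓ and the calculus of Fourier expansions. -/

theorem norm_ell_le (r : ℕ) (n : ℤ) : ‖ell r n‖ ≤ 2 ^ r := by
  rw [ell]
  split_ifs with hn
  · rw [norm_zero]; positivity
  have h1 : (1 : ℝ) ≤ ‖(n : ℂ)‖ := by
    rw [norm_intCast]; exact_mod_cast Int.one_le_abs hn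
  have e : ((r : ℂ) + 1 / 2) = (((r : ℝ) + 1 / 2 : ℝ) : ℂ) := by push_cast; rfl
  rw [norm_div, norm_pow, e, Complex.norm_cpow_real, div_le_iff₀ (by positivity)]
  calc ‖(n : ℂ) + 1‖ ^ r ≤ (2 * ‖(n : ℂ)‖) ^ r := by
        gcongr
        calc ‖(n : ℂ) + 1‖ ≤ ‖(n : ℂ)‖ + ‖(1 : ℂ)‖ := norm_add_le _ _
          _ ≤ 2 * ‖(n : ℂ)‖ := by rw [norm_one]; linarith
    _ = 2 ^ r * ‖(n : ℂ)‖ ^ (r : ℝ) := by rw [mul_pow, Real.rpow_natCast]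
    _ ≤ 2 ^ r * ‖(n : ℂ)‖ ^ ((r : ℝ) + 1 / 2) := by
        gcongr
        linarith

theorem ell_mul_cpow (r : ℕ) {n : ℤ} (hn : n ≠ 0) :
    ell r n * (n : ℂ) ^ ((r : ℂ) + 1 / 2) = ((n : ℂ) + 1) ^ r := by
  have h0 : (n : ℂ) ≠ 0 := by exact_mod_cast hn
  rw [ell, if_neg hn, div_mul_cancel₀]
  rw [Ne, cpow_eq_zero_iff]; tauto

theorem qPow_add (a b : ℤ) (z : ℍ) : qPow (a + b) z = qPow a z * qPow b z := by
  rw [qPow, qPow, qPow, ← Complex.exp_add]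
  congr 1; push_cast; ring

theorem qPow_eq_zpow (n : ℤ) (z : ℍ) : qPow n z = qPow 1 z ^ n := by
  rw [qPow, qPow, ← Complex.exp_int_mul]
  congr 1; push_cast; ring

theorem norm_qPow_one_lt (z : ℍ) : ‖qPow 1 z‖ < 1 := by
  rw [qPow, Complex.norm_exp, Real.exp_lt_one_iff]
  have : (2 * Real.pi * I * ((1 : ℤ) : ℂ) * (z : ℂ)).re = -(2 * Real.pi * z.im) := by simp
  rw [this]
  have := z.im_pos
  have := Real.pi_pos
  nlinarith [mul_pos this z.im_pos]

/-- Transfers convergence and non-vanishing from ℍ to the punctured unit disc. -/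
theorem exists_qPow_eq {q : ℂ} (h0 : q ≠ 0) (h1 : ‖q‖ < 1) : ∃ z : ℍ, qPow 1 z = q := by
  refine ⟨⟨Function.Periodic.invQParam 1 q, ?_⟩, ?_⟩
  · rw [Function.Periodic.im_invQParam]
    have := Real.log_neg (norm_pos_iff.2 h0) h1
    have := Real.pi_pos
    exact mul_pos_of_neg_of_neg (by rw [neg_div, neg_lt_zero]; positivity) ‹_›
  · have := Function.Periodic.qParam_right_inv (h := 1) one_ne_zero h0
    rw [Function.Periodic.qParam] at this
    rw [qPow]
    convert this using 2
    push_cast; simp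

theorem HasFourierExpansion.mul {f g : ℍ → ℂ} {n₀ n₁ : ℤ} {c e : ℤ → ℂ}
    (hf : HasFourierExpansion f n₀ c) (hg : HasFourierExpansion g n₁ e) :
    HasFourierExpansion (f * g) (n₀ + n₁)
      (fun n => ∑ l ∈ Finset.Icc (-n₀) (n + n₁), c l * e (n - l)) := by
  refine ⟨fun n hn => ?_, fun z => ?_⟩
  · beta_reduce
    rw [Finset.Icc_eq_empty (by omega), Finset.sum_empty]
  · have h1 := hf.2 z
    have h2 := hg.2 z
    have hs : Summable fun x : ℤ × ℤ => c x.1 * qPow x.1 z * (e x.2 * qPow x.2 z) :=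
      summable_mul_of_summable_norm (f := fun n => c n * qPow n z) (g := fun n => e n * qPow n z)
        h1.summable.norm h2.summable.norm
    have h3 := HasSum.mul (f := fun n => c n * qPow n z) (g := fun n => e n * qPow n z) h1 h2 hs
    -- Groups the pairs of exponents by their sum n, with the first exponent l as second coordinate;
    -- the lower bounds on both expansions make each group finite.
    let E : ℤ × ℤ ≃ ℤ × ℤ :=
      ⟨fun p => (p.2, p.1 - p.2), fun p => (p.1 + p.2, p.1), fun p => by simp, fun p => by simp⟩
    refine ((E.hasSum_iff).2 h3).prod_fiberwise fun n => ?_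
    rw [Finset.sum_mul]
    have : ∀ l : ℤ, ((fun x : ℤ × ℤ => c x.1 * qPow x.1 z * (e x.2 * qPow x.2 z)) ∘ E) (n, l) =
        c l * e (n - l) * qPow n z := by
      intro l
      simp only [E, Function.comp_apply, Equiv.coe_fn_mk]
      have := qPow_add l (n - l) z
      rw [add_sub_cancel] at this
      rw [this]; ring
    simp_rw [this]
    refine hasSum_sum_of_ne_finset_zero fun l hl => ?_
    rw [Finset.mem_Icc, not_and_or] at hl
    rcases hl with hl | hl
    · rw [hf.1 l (by omega)]; simp
    · rw [hg.1 (n - l) (by omega)]; simp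

theorem HasFourierExpansion.normalizedDeriv {f : ℍ → ℂ} {n₀ : ℤ} {c : ℤ → ℂ}
    (hf : HasFourierExpansion f n₀ c) :
    HasFourierExpansion (normalizedDerivOfComplex f) n₀ (fun n => n * c n) := by
  refine ⟨fun n hn => by simp [hf.1 n hn], fun z => ?_⟩
  set F : ℤ → ℂ → ℂ := fun n w => c n * cexp (2 * Real.pi * I * n * w) with hF
  have hnorm : ∀ (n : ℤ) (w : ℂ), ‖cexp (2 * Real.pi * I * n * w)‖ =
      Real.exp (-(2 * Real.pi * n * w.im)) := by
    intro n w
    rw [Complex.norm_exp]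
    congr 1
    have : (2 * Real.pi * I * n * w : ℂ) = ((2 * Real.pi * n : ℝ) : ℂ) * (I * w) := by
      push_cast; ring
    rw [this, Complex.re_ofReal_mul, Complex.I_mul_re]; ring
  have hz := z.im_pos
  -- Termwise differentiation needs a uniform bound on the strip between heights y/2 and 2y. Terms
  -- with n ≥ 0 are largest at the lower height and those with n ≤ 0 at the upper, so the sum of
  -- both values dominates.
  set z0 : ℍ := ⟨((z.im / 2 : ℝ) : ℂ) * I, by simpa using hz⟩ with hz0
  set z1 : ℍ := ⟨((2 * z.im : ℝ) : ℂ) * I, by simpa using hz⟩ with hz1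
  have hu : Summable fun n : ℤ => ‖c n * qPow n z0‖ + ‖c n * qPow n z1‖ :=
    (hf.2 z0).summable.norm.add (hf.2 z1).summable.norm
  set U : Set ℂ := {w | z.im / 2 < w.im} ∩ {w | w.im < 2 * z.im} with hU
  have hUo : IsOpen U := (isOpen_lt continuous_const Complex.continuous_im).inter
    (isOpen_lt Complex.continuous_im continuous_const)
  have hzU : (z : ℂ) ∈ U := by
    constructor
    · change z.im / 2 < z.im; linarith
    · change z.im < 2 * z.im; linarith
  have key := Complex.hasSum_deriv_of_summable_norm (F := F) hu
    (fun n => by simp only [hF]; fun_prop) hUo (fun n w hw => by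
      have e0 : ‖qPow n z0‖ = Real.exp (-(2 * Real.pi * n * (z.im / 2))) := by
        rw [qPow, hnorm, hz0]; simp
      have e1 : ‖qPow n z1‖ = Real.exp (-(2 * Real.pi * n * (2 * z.im))) := by
        rw [qPow, hnorm, hz1]; simp
      rw [hF]
      simp only [norm_mul]
      rw [hnorm, e0, e1, ← mul_add]
      refine mul_le_mul_of_nonneg_left ?_ (norm_nonneg _)
      rcases le_total 0 n with hn | hn
      · have hn' : (0 : ℝ) ≤ n := by exact_mod_cast hn
        refine le_add_of_le_of_nonneg (Real.exp_le_exp.2 (neg_le_neg ?_)) (Real.exp_pos _).le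
        exact mul_le_mul_of_nonneg_left hw.1.le (by positivity)
      · have hn' : (n : ℝ) ≤ 0 := by exact_mod_cast hn
        refine le_add_of_nonneg_of_le (Real.exp_pos _).le (Real.exp_le_exp.2 (neg_le_neg ?_))
        exact mul_le_mul_of_nonpos_left hw.2.le (mul_nonpos_of_nonneg_of_nonpos (by positivity) hn'))
    hzU
  have hcongr : f ∘ UpperHalfPlane.ofComplex =ᶠ[𝓝 (z : ℂ)] fun w => ∑' n, F n w := by
    filter_upwards [UpperHalfPlane.isOpen_upperHalfPlaneSet.mem_nhds z.im_pos] with w hw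
    rw [Function.comp_apply, UpperHalfPlane.ofComplex_apply_of_im_pos hw]
    exact (hf.2 ⟨w, hw⟩).tsum_eq.symm
  rw [Derivative.normalizedDerivOfComplex, hcongr.deriv_eq]
  refine (key.mul_left _).congr_fun fun n => ?_
  have hd : HasDerivAt (F n) (c n * (cexp (2 * Real.pi * I * n * z) * (2 * Real.pi * I * n))) (z : ℂ) := by
    have h1 : HasDerivAt (fun w : ℂ => 2 * Real.pi * I * n * w) (2 * Real.pi * I * n) (z : ℂ) := by
      simpa using (hasDerivAt_id (z : ℂ)).const_mul (2 * Real.pi * I * n)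
    exact h1.cexp.const_mul _
  rw [hd.deriv, qPow]
  have := Complex.two_pi_I_ne_zero
  field_simp

theorem HasFourierExpansion.iterate_normalizedDeriv {f : ℍ → ℂ} {n₀ : ℤ} {c : ℤ → ℂ}
    (hf : HasFourierExpansion f n₀ c) (r : ℕ) :
    HasFourierExpansion (normalizedDerivOfComplex^[r] f) n₀ (fun n => (n : ℂ) ^ r * c n) := by
  induction r with
  | zero => simpa using hf
  | succ r ih =>
    rw [Function.iterate_succ_apply']
    convert ih.normalizedDeriv using 2 with n
    rw [pow_succ]; ring

theorem hasFourierExpansion_of_sq {f : ℍ → ℂ} {a : ℕ → ℂ} (h0 : a 0 = 0)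
    (hf : ∀ z, HasSum (fun n : ℕ => a n * qPow ((n : ℤ) ^ 2) z) (f z)) :
    ∃ t : ℤ → ℂ, HasFourierExpansion f (-1) t ∧ t 1 = a 1 := by
  have hinj : Function.Injective fun n : ℕ => (n : ℤ) ^ 2 := fun x y h => by
    have h' : (x : ℤ) ^ 2 = (y : ℤ) ^ 2 := h
    exact_mod_cast (pow_left_inj₀ (by positivity) (by positivity) two_ne_zero).1 h'
  refine ⟨Function.extend (fun n : ℕ => (n : ℤ) ^ 2) a 0, ⟨fun n hn => ?_, fun z => ?_⟩, ?_⟩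
  · by_cases h : ∃ m : ℕ, (m : ℤ) ^ 2 = n
    · obtain ⟨m, rfl⟩ := h
      have : m = 0 := by
        rcases Nat.eq_zero_or_pos m with h | h
        · exact h
        · have : (0 : ℤ) < (m : ℤ) ^ 2 := by positivity
          omega
      subst this
      rw [hinj.extend_apply a 0 0, h0]
    · rw [Function.extend_apply' _ _ _ h]; rfl
  · rw [← hinj.hasSum_iff]
    · refine (hf z).congr_fun fun n => ?_
      rw [Function.comp_apply, hinj.extend_apply]
    · intro n hn
      rw [Function.extend_apply' _ _ _ hn]; simp
  · exact hinj.extend_apply a 0 1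

/-- Write f = q G(q) with G(0) = 1. Since f has no zeros on ℍ, G has none in the unit disc, so the
Taylor series of G^(-2) converges on the whole disc and the expansion is valid on all of ℍ. -/
theorem HasFourierExpansion.inv_sq {f : ℍ → ℂ} {t : ℤ → ℂ} (hf : HasFourierExpansion f (-1) t)
    (ht : t 1 = 1) (hf0 : ∀ z, f z ≠ 0) :
    ∃ g : ℤ → ℂ, HasFourierExpansion (fun z => f z ^ (-2 : ℤ)) 2 g ∧ g (-2) = 1 := by
  set G : ℂ → ℂ := fun q => ∑' m : ℕ, t (m + 1) * q ^ m with hG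
  have hinj : Function.Injective fun m : ℕ => (m : ℤ) + 1 := fun x y h => by simpa using h
  have hsupp : ∀ z : ℍ, ∀ n ∉ Set.range (fun m : ℕ => (m : ℤ) + 1), t n * qPow n z = 0 := by
    intro z n hn
    have : n < 1 := by
      by_contra h
      exact hn ⟨(n - 1).toNat, by simp only []; omega⟩
    rw [hf.1 n (by omega), zero_mul]
  have hpow : ∀ (z : ℍ) (m : ℕ), qPow ((m : ℤ) + 1) z = qPow 1 z * qPow 1 z ^ m := by
    intro z m
    rw [qPow_add, qPow_eq_zpow, zpow_natCast, mul_comm]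
  have hfG : ∀ z, f z = qPow 1 z * G (qPow 1 z) := by
    intro z
    rw [← ((hinj.hasSum_iff (hsupp z)).2 (hf.2 z)).tsum_eq, hG, ← tsum_mul_left]
    refine tsum_congr fun m => ?_
    rw [Function.comp_apply, hpow]; ring
  have hsum : ∀ ρ : ℝ, 0 < ρ → ρ < 1 → Summable fun m : ℕ => ‖t (m + 1)‖ * ρ ^ m := by
    intro ρ h0 h1
    obtain ⟨z, hz⟩ := exists_qPow_eq (q := (ρ : ℂ)) (by exact_mod_cast h0.ne')
      (by simpa [abs_of_pos h0] using h1)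
    have := (((hinj.hasSum_iff (hsupp z)).2 (hf.2 z)).summable.norm).mul_left ρ⁻¹
    refine this.congr fun m => ?_
    rw [Function.comp_apply, hpow, hz]
    simp only [norm_mul, norm_pow, Complex.norm_real, Real.norm_eq_abs, abs_of_pos h0]
    field_simp
  have hGd : DifferentiableOn ℂ G (Metric.ball 0 1) := by
    intro q hq
    obtain ⟨ρ, hρ, hρ1⟩ := exists_between (mem_ball_zero_iff.1 hq)
    have h0 : 0 < ρ := (norm_nonneg q).trans_lt hρ
    have hd : DifferentiableOn ℂ G (Metric.ball 0 ρ) := by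
      refine Complex.differentiableOn_tsum_of_summable_norm (hsum ρ h0 hρ1) (fun n => by fun_prop)
        Metric.isOpen_ball ?_
      intro n w hw
      rw [norm_mul, norm_pow]
      gcongr
      exact (mem_ball_zero_iff.1 hw).le
    exact (hd.differentiableAt (Metric.isOpen_ball.mem_nhds
      (mem_ball_zero_iff.2 hρ))).differentiableWithinAt
  have hG0 : G 0 = 1 := by
    simp only [hG]
    rw [tsum_eq_single 0]
    · simpa using ht
    · intro m hm; simp [hm]
  have hGne : ∀ q ∈ Metric.ball (0 : ℂ) 1, G q ≠ 0 := by
    intro q hq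
    by_cases h : q = 0
    · rw [h, hG0]; exact one_ne_zero
    · obtain ⟨z, rfl⟩ := exists_qPow_eq h (mem_ball_zero_iff.1 hq)
      intro h'
      exact hf0 z (by rw [hfG, h', mul_zero])
  have hK : DifferentiableOn ℂ (fun q => (G q ^ 2)⁻¹) (Metric.ball 0 1) :=
    (hGd.pow 2).inv fun q hq => pow_ne_zero 2 (hGne q hq)
  set k : ℕ → ℂ := fun n => (n.factorial : ℂ)⁻¹ * iteratedDeriv n (fun q => (G q ^ 2)⁻¹) 0 with hk
  have hinj2 : Function.Injective fun m : ℕ => (m : ℤ) - 2 := fun x y h => by simpa using h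
  refine ⟨Function.extend (fun m : ℕ => (m : ℤ) - 2) k 0, ⟨fun n hn => ?_, fun z => ?_⟩, ?_⟩
  · rw [Function.extend_apply']
    · rfl
    · rintro ⟨m, hm⟩
      omega
  · rw [← hinj2.hasSum_iff]
    · have := (Complex.hasSum_taylorSeries_on_ball hK
        (mem_ball_zero_iff.2 (norm_qPow_one_lt z))).mul_left (qPow (-2) z)
      have e : qPow (-2) z * (G (qPow 1 z) ^ 2)⁻¹ = f z ^ (-2 : ℤ) := by
        rw [hfG, mul_zpow, ← qPow_eq_zpow, zpow_neg]
        rfl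
      rw [e] at this
      refine this.congr_fun fun m => ?_
      rw [Function.comp_apply, hinj2.extend_apply, sub_zero, smul_eq_mul, smul_eq_mul,
        sub_eq_add_neg, qPow_add, qPow_eq_zpow m, zpow_natCast, hk]
      ring
    · intro n hn
      rw [Function.extend_apply' _ _ _ hn]; simp
  · have := hinj2.extend_apply k 0 0
    simp only [Nat.cast_zero, zero_sub] at this
    rw [this, hk]
    simp [hG0]

theorem exists_bol_coefficients {θ U : ℍ → ℂ} {t u : ℤ → ℂ} (hθ : HasFourierExpansion θ (-1) t)
    (ht : t 1 = 1) (hU : HasFourierExpansion U 1 u) (hu : u (-1) = 1) (r : ℕ) :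
    ∃ A : ℤ → ℤ → ℂ, ∀ (f : ℍ → ℂ) (n₀ : ℤ) (c : ℤ → ℂ), HasFourierExpansion f n₀ c →
      HasFourierExpansion (normalizedDerivOfComplex^[r] (f * θ) * U) n₀
        (fun n => c n * ((n : ℂ) + 1) ^ r + ∑ l ∈ Finset.Ico (-n₀) n, A n l * c l) := by
  -- The index s is the exponent at which D^r acts: s ≥ l + 1 because θ starts at q, and s ≤ n + 1
  -- because U starts at q^(-1). For l = n only s = n + 1 remains, giving the leading factor
  -- (n+1)^r.
  refine ⟨fun n l => ∑ s ∈ Finset.Icc (l + 1) (n + 1), (s : ℂ) ^ r * t (s - l) * u (n - s),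
    fun f n₀ c hf => ?_⟩
  have h := ((hf.mul hθ).iterate_normalizedDeriv r).mul hU
  rw [show n₀ + -1 + 1 = n₀ by ring] at h
  convert h using 2 with n
  set A : ℤ → ℂ := fun l => ∑ s ∈ Finset.Icc (l + 1) (n + 1), (s : ℂ) ^ r * t (s - l) * u (n - s) with hA
  have hAn : A n = ((n : ℂ) + 1) ^ r := by
    simp only [hA, Finset.Icc_self, Finset.sum_singleton]
    rw [add_sub_cancel_left, ht, show n - (n + 1) = -1 by ring, hu]
    push_cast; ring
  have hswap : ∑ s ∈ Finset.Icc (-(n₀ + -1)) (n + 1), (s : ℂ) ^ r *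
      (∑ l ∈ Finset.Icc (-n₀) (s + -1), c l * t (s - l)) * u (n - s)
      = ∑ l ∈ Finset.Icc (-n₀) n, A l * c l := by
    simp_rw [hA, Finset.mul_sum, Finset.sum_mul]
    rw [Finset.sum_comm' (t' := Finset.Icc (-n₀) n) (s' := fun l => Finset.Icc (l + 1) (n + 1))]
    · refine Finset.sum_congr rfl fun l _ => Finset.sum_congr rfl fun s _ => ?_
      ring
    · intro s l
      simp only [Finset.mem_Icc]
      omega
  rw [hswap]
  by_cases hn : -n₀ ≤ n
  · rw [← Finset.Ico_insert_right hn, Finset.sum_insert (by simp), hAn, mul_comm]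
  · rw [Finset.Icc_eq_empty hn, Finset.Ico_eq_empty (by omega), hf.1 n (by omega)]
    simp

/-! ### Holomorphy, characters and modularity of the operator. -/

theorem mdifferentiable_charTheta (ν : ℕ) {N : ℕ} (χ : DirichletCharacter ℂ N) :
    MDifferentiable 𝓘(ℂ) 𝓘(ℂ) (charTheta ν χ) := by
  rw [UpperHalfPlane.mdifferentiable_iff]
  have h : DifferentiableOn ℂ
      (fun w : ℂ => thetaSeries ν (fun n => χ n) (cexp (Real.pi * I * (2 * w)))) {w | 0 < w.im} := by
    intro w hw
    have hq : ‖cexp (Real.pi * I * (2 * w))‖ < 1 := by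
      have := norm_qPow_one_lt ⟨w, hw⟩
      rw [qPow] at this
      convert this using 3
      push_cast; ring
    have h1 := thetaSeries_differentiableAt ν (norm_dirichlet_le χ) hq
    exact (DifferentiableAt.comp (f := fun w : ℂ => cexp (Real.pi * I * (2 * w))) w h1
      (by fun_prop)).differentiableWithinAt
  refine h.congr fun w hw => ?_
  rw [Function.comp_apply, UpperHalfPlane.ofComplex_apply_of_im_pos hw, charTheta,
    thetaSum_eq_thetaSeries]

theorem mdifferentiable_inv {f : ℍ → ℂ} (hf : MDifferentiable 𝓘(ℂ) 𝓘(ℂ) f) (h0 : ∀ z, f z ≠ 0) :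
    MDifferentiable 𝓘(ℂ) 𝓘(ℂ) f⁻¹ := by
  rw [UpperHalfPlane.mdifferentiable_iff] at hf ⊢
  exact hf.inv fun w _ => h0 _

theorem iterate_normalizedDeriv_add {f g : ℍ → ℂ} (hf : MDifferentiable 𝓘(ℂ) 𝓘(ℂ) f)
    (hg : MDifferentiable 𝓘(ℂ) 𝓘(ℂ) g) (r : ℕ) :
    normalizedDerivOfComplex^[r] (f + g) =
      normalizedDerivOfComplex^[r] f + normalizedDerivOfComplex^[r] g := by
  induction r with
  | zero => rfl
  | succ r ih =>
    simp only [Function.iterate_succ_apply']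
    rw [ih, Derivative.normalizedDerivOfComplex_add _ _
      (mdifferentiable_iterate_normalizedDeriv hf r) (mdifferentiable_iterate_normalizedDeriv hg r)]

theorem iterate_normalizedDeriv_smul (a : ℂ) {f : ℍ → ℂ} (hf : MDifferentiable 𝓘(ℂ) 𝓘(ℂ) f)
    (r : ℕ) : normalizedDerivOfComplex^[r] (a • f) = a • normalizedDerivOfComplex^[r] f := by
  induction r with
  | zero => rfl
  | succ r ih =>
    simp only [Function.iterate_succ_apply']
    rw [ih, Derivative.normalizedDerivOfComplex_smul _ _
      (mdifferentiable_iterate_normalizedDeriv hf r)]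

theorem theta0_eq_smul {M : ℕ} {χ : DirichletCharacter ℂ M} (hχ : χ.Even) (h0 : χ 0 = 0) :
    theta0 χ = (1 / 2 : ℂ) • charTheta 0 χ := funext fun z => theta0_eq hχ h0 z

theorem theta1_eq_smul {M : ℕ} {χ : DirichletCharacter ℂ M} (hχ : χ.Odd) :
    theta1 χ = (1 / 2 : ℂ) • charTheta 1 χ := funext fun z => theta1_eq hχ z

theorem dirichlet_map_zero {M : ℕ} {χ : DirichletCharacter ℂ M} (hχ : χ ≠ 1) : χ 0 = 0 := by
  apply MulChar.map_nonunit
  rw [isUnit_zero_iff]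
  intro h
  have : M = 1 := by
    have h1 : Subsingleton (ZMod M) := subsingleton_of_zero_eq_one h
    exact (ZMod.subsingleton_iff).1 h1
  subst this
  exact hχ (DirichletCharacter.level_one χ)

theorem exists_theta0_expansion {M : ℕ} {χ : DirichletCharacter ℂ M} (h0 : χ 0 = 0) :
    ∃ t : ℤ → ℂ, HasFourierExpansion (theta0 χ) (-1) t ∧ t 1 = 1 := by
  obtain ⟨t, ht, h1⟩ := hasFourierExpansion_of_sq (f := theta0 χ) (a := fun n : ℕ => χ (n : ZMod M))
    (by simpa using h0) fun z => by
      have hz : 0 < (2 * (z : ℂ)).im := by simpa using z.im_pos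
      have := (summable_thetaSum_term 0 (norm_dirichlet_le χ) hz).comp_injective
        (Nat.cast_injective (R := ℤ))
      refine (this.congr fun n => ?_).hasSum
      rw [Function.comp_apply, qPow]
      push_cast
      rw [pow_zero, mul_one]
      congr 2; ring
  exact ⟨t, ht, by simpa using h1⟩

theorem exists_theta1_expansion {M : ℕ} (χ : DirichletCharacter ℂ M) :
    ∃ t : ℤ → ℂ, HasFourierExpansion (theta1 χ) (-1) t ∧ t 1 = 1 := by
  obtain ⟨t, ht, h1⟩ := hasFourierExpansion_of_sq (f := theta1 χ)
    (a := fun n : ℕ => (n : ℂ) * χ (n : ZMod M)) (by simp) fun z => by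
      have hz : 0 < (2 * (z : ℂ)).im := by simpa using z.im_pos
      have := (summable_thetaSum_term 1 (norm_dirichlet_le χ) hz).comp_injective
        (Nat.cast_injective (R := ℤ))
      refine (this.congr fun n => ?_).hasSum
      rw [Function.comp_apply, qPow]
      push_cast
      rw [pow_one, mul_comm (n : ℂ)]
      congr 2; ring
  exact ⟨t, ht, by simpa using h1⟩

theorem bolOperator_zero_eq {N₀ N₁ : ℕ} (ψ₀ : DirichletCharacter ℂ N₀)
    (ψ₁ : DirichletCharacter ℂ N₁) (r : ℕ) (f : ℍ → ℂ) :
    bolOperator ψ₀ ψ₁ 0 r f = normalizedDerivOfComplex^[r] (f * theta0 ψ₀) *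
      fun z => theta0 ψ₀ z ^ (-2 : ℤ) * theta1 ψ₁ z := by
  funext z
  have : (fun w => theta0 ψ₀ w ^ (1 - 3 * (0 : ℤ)) * theta1 ψ₁ w ^ (0 : ℤ) * f w) = f * theta0 ψ₀ := by
    funext w; simp [mul_comm]
  rw [bolOperator, this]
  simp [mul_comm]

theorem eps_pow_two {d : ℤ} (hd : Odd d) : eps d ^ 2 = chiNegOne (d : ZMod 4) := by
  have hd2 := Int.odd_iff.1 hd
  have h4 : d % 4 = 1 ∨ d % 4 = 3 := by omega
  rw [chiNegOne, MulChar.ringHomComp_apply]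
  rcases h4 with h | h
  · rw [ZMod.χ₄_int_one_mod_four h, eps, if_pos h]; simp
  · rw [ZMod.χ₄_int_three_mod_four h, eps, if_neg (by omega)]; simp

theorem eps_pow_four (d : ℤ) : eps d ^ 4 = 1 := by
  rw [eps]; split_ifs <;> simp

theorem eps_ne_zero (d : ℤ) : eps d ≠ 0 := by
  rw [eps]; split_ifs <;> simp

theorem kroneckerOdd_sq {c d : ℤ} (h : IsCoprime c d) : (kroneckerOdd c d : ℂ) ^ 2 = 1 := by
  have hg : c.gcd d.natAbs = 1 := by
    have := Int.isCoprime_iff_gcd_eq_one.1 h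
    rwa [Int.gcd, Int.natAbs_natCast]
  have h1 : kroneckerOdd c d ^ 2 = 1 := by
    rw [kroneckerOdd, mul_pow, jacobiSym.sq_one hg]
    split_ifs <;> norm_num
  exact_mod_cast congrArg (Int.cast : ℤ → ℂ) h1

theorem changeLevel_intCast {n m : ℕ} (h : n ∣ m) (χ : DirichletCharacter ℂ n) {d : ℤ}
    (hd : IsUnit (d : ZMod m)) : DirichletCharacter.changeLevel h χ (d : ZMod m) = χ (d : ZMod n) := by
  have := DirichletCharacter.changeLevel_eq_cast_of_dvd χ h hd.unit
  rw [IsUnit.unit_spec] at this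
  rw [this, ZMod.cast_intCast h]

theorem targetCharacter_apply {N N₀ N₁ : ℕ} (hN : Nat.lcm (4 * N₀ ^ 2) (4 * N₁ ^ 2) ∣ N)
    (ψ : DirichletCharacter ℂ N) (ψ₀ : DirichletCharacter ℂ N₀) (ψ₁ : DirichletCharacter ℂ N₁)
    {d : ℤ} (hd : IsUnit (d : ZMod N)) :
    targetCharacter hN ψ ψ₀ ψ₁ (d : ZMod N) = ψ (d : ZMod N) * chiNegOne (d : ZMod 4) *
      ψ₁ (d : ZMod N₁) * (ψ₀ (d : ZMod N₀))⁻¹ := by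
  rw [targetCharacter, MulChar.mul_apply, MulChar.mul_apply, MulChar.mul_apply,
    MulChar.inv_apply_eq_inv', changeLevel_intCast _ _ hd, changeLevel_intCast _ _ hd,
    changeLevel_intCast _ _ hd]

theorem mdifferentiable_theta0 {M : ℕ} {χ : DirichletCharacter ℂ M} (hχ : χ.Even) (h0 : χ 0 = 0) :
    MDifferentiable 𝓘(ℂ) 𝓘(ℂ) (theta0 χ) := by
  rw [theta0_eq_smul hχ h0]; exact (mdifferentiable_charTheta 0 χ).const_smul _

theorem mdifferentiable_theta1 {M : ℕ} {χ : DirichletCharacter ℂ M} (hχ : χ.Odd) :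
    MDifferentiable 𝓘(ℂ) 𝓘(ℂ) (theta1 χ) := by
  rw [theta1_eq_smul hχ]; exact (mdifferentiable_charTheta 1 χ).const_smul _

theorem theta0_smul {M : ℕ} [NeZero M] {χ : DirichletCharacter ℂ M} (hχ : χ.Even) (h0 : χ 0 = 0)
    {γ : SL(2, ℤ)} (hγ : ((4 * M ^ 2 : ℕ) : ℤ) ∣ γ 1 0) (z : ℍ) :
    eps (γ 1 1) * theta0 χ (γ • z) = kroneckerOdd (γ 1 0) (γ 1 1) * χ (γ 1 1 : ℤ) *
        (((γ 1 0 : ℤ) : ℂ) * z + ((γ 1 1 : ℤ) : ℂ)) ^ (1 / 2 : ℂ) * theta0 χ z := by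
  have := charTheta_smul (ν := 0) (by norm_num) χ (by rw [pow_zero]; exact hχ) hγ z
  rw [theta0_eq hχ h0, theta0_eq hχ h0]
  linear_combination (1 / 2 : ℂ) * this

theorem theta1_smul {M : ℕ} [NeZero M] {χ : DirichletCharacter ℂ M} (hχ : χ.Odd)
    {γ : SL(2, ℤ)} (hγ : ((4 * M ^ 2 : ℕ) : ℤ) ∣ γ 1 0) (z : ℍ) :
    eps (γ 1 1) * theta1 χ (γ • z) = kroneckerOdd (γ 1 0) (γ 1 1) * χ (γ 1 1 : ℤ) *
        (((γ 1 0 : ℤ) : ℂ) * z + ((γ 1 1 : ℤ) : ℂ)) ^ (1 / 2 : ℂ) *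
        (((γ 1 0 : ℤ) : ℂ) * z + ((γ 1 1 : ℤ) : ℂ)) * theta1 χ z := by
  have := charTheta_smul (ν := 1) le_rfl χ (by rw [pow_one]; exact hχ) hγ z
  rw [theta1_eq hχ, theta1_eq hχ]
  linear_combination (1 / 2 : ℂ) * this

theorem isWeaklyHolomorphic_bolOperator {N₀ N₁ : ℕ} [NeZero N₀] [NeZero N₁]
    {ψ₀ : DirichletCharacter ℂ N₀} {ψ₁ : DirichletCharacter ℂ N₁}
    (hψ₀even : ψ₀.Even) (hψ₁odd : ψ₁.Odd) (hψ₀ : ψ₀ 0 = 0)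
    (hθ₀ : ∀ z, theta0 ψ₀ z ≠ 0) (r : ℕ) {N : ℕ}
    (hN : Nat.lcm (4 * N₀ ^ 2) (4 * N₁ ^ 2) ∣ N) {ψ : DirichletCharacter ℂ N} {f : ℍ → ℂ}
    (hf : IsWeaklyHolomorphic (1 - 2 * (r : ℤ)) N ψ f) :
    IsWeaklyHolomorphic (2 * (r : ℤ) + 3) N (targetCharacter hN ψ ψ₀ ψ₁)
      (bolOperator ψ₀ ψ₁ 0 r f) := by
  have hd0 := mdifferentiable_theta0 hψ₀even hψ₀
  have hd1 := mdifferentiable_theta1 hψ₁odd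
  have hh : MDifferentiable 𝓘(ℂ) 𝓘(ℂ) (f * theta0 ψ₀) := hf.holo.mul hd0
  have hU : (fun z => theta0 ψ₀ z ^ (-2 : ℤ) * theta1 ψ₁ z) =
      (theta0 ψ₀)⁻¹ * (theta0 ψ₀)⁻¹ * theta1 ψ₁ := by
    funext z
    simp only [Pi.mul_apply, Pi.inv_apply, zpow_neg]
    rw [← mul_inv, ← sq]; rfl
  rw [bolOperator_zero_eq, hU]
  refine ⟨?_, fun γ hγ z => ?_, fun γ => ?_⟩
  · have hi := mdifferentiable_inv hd0 hθ₀
    exact (mdifferentiable_iterate_normalizedDeriv hh r).mul ((hi.mul hi).mul hd1)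
  · have hNc : (N : ℤ) ∣ γ 1 0 := by
      rw [CongruenceSubgroup.Gamma0_mem] at hγ
      exact (ZMod.intCast_zmod_eq_zero_iff_dvd _ _).1 hγ
    have h0c : ((4 * N₀ ^ 2 : ℕ) : ℤ) ∣ γ 1 0 :=
      (Int.natCast_dvd_natCast.2 ((Nat.dvd_lcm_left _ _).trans hN)).trans hNc
    have h1c : ((4 * N₁ ^ 2 : ℕ) : ℤ) ∣ γ 1 0 :=
      (Int.natCast_dvd_natCast.2 ((Nat.dvd_lcm_right _ _).trans hN)).trans hNc
    have hdet := det_SL γ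
    have hodd : Odd (γ 1 1) :=
      odd_of_det hdet ((Int.natCast_dvd_natCast.2 (Dvd.intro _ rfl)).trans h0c)
    have hcop : IsCoprime (γ 1 0) (γ 1 1) := ⟨-γ 0 1, γ 0 0, by linear_combination hdet⟩
    have hunit : ∀ M : ℕ, (M : ℤ) ∣ γ 1 0 → IsUnit ((γ 1 1 : ℤ) : ZMod M) := by
      intro M hM
      have h := congrArg (Int.cast : ℤ → ZMod M) hdet
      push_cast at h
      rw [(ZMod.intCast_zmod_eq_zero_iff_dvd _ _).2 hM, mul_zero, sub_zero] at h
      exact IsUnit.of_mul_eq_one _ ((mul_comm _ _).trans h)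
    rw [targetCharacter_apply hN ψ ψ₀ ψ₁ (hunit N hNc), ← eps_pow_two hodd]
    have hk := kroneckerOdd_sq hcop
    have hε4 := eps_pow_four (γ 1 1)
    have hε := eps_ne_zero (γ 1 1)
    have hw := fun z => SL_denom_ne_zero γ z
    have hQ : ∀ z, eps (γ 1 1) * preSlash 1 (theta0 ψ₀) γ z =
        kroneckerOdd (γ 1 0) (γ 1 1) * ψ₀ ((γ 1 1 : ℤ) : ZMod N₀) * theta0 ψ₀ z := by
      intro z
      have h := theta0_smul hψ₀even hψ₀ h0c z
      have hc := cpow_add (-((1 : ℤ) : ℂ) / 2) (1 / 2) (hw z)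
      rw [show -((1 : ℤ) : ℂ) / 2 + 1 / 2 = 0 by push_cast; ring, cpow_zero] at hc
      rw [preSlash]
      linear_combination
        (((γ 1 0 : ℤ) : ℂ) * z + ((γ 1 1 : ℤ) : ℂ)) ^ (-((1 : ℤ) : ℂ) / 2) * h -
        (kroneckerOdd (γ 1 0) (γ 1 1) * ψ₀ ((γ 1 1 : ℤ) : ZMod N₀) * theta0 ψ₀ z) * hc
    have hR : ∀ z, eps (γ 1 1) * preSlash 3 (theta1 ψ₁) γ z =
        kroneckerOdd (γ 1 0) (γ 1 1) * ψ₁ ((γ 1 1 : ℤ) : ZMod N₁) * theta1 ψ₁ z := by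
      intro z
      have h := theta1_smul hψ₁odd h1c z
      have hc1 := cpow_add (-((3 : ℤ) : ℂ) / 2) (1 / 2) (hw z)
      have hc := cpow_add (-((3 : ℤ) : ℂ) / 2 + 1 / 2) 1 (hw z)
      rw [show -((3 : ℤ) : ℂ) / 2 + 1 / 2 + 1 = 0 by push_cast; ring, cpow_zero, cpow_one, hc1] at hc
      rw [preSlash]
      linear_combination
        (((γ 1 0 : ℤ) : ℂ) * z + ((γ 1 1 : ℤ) : ℂ)) ^ (-((3 : ℤ) : ℂ) / 2) * h -
        (kroneckerOdd (γ 1 0) (γ 1 1) * ψ₁ ((γ 1 1 : ℤ) : ZMod N₁) * theta1 ψ₁ z) * hc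
    -- The Kronecker symbols of f and θ₀ multiply to 1, so the product has integral weight with a
    -- constant multiplier, which commutes with D^r.
    have hslash : (f * theta0 ψ₀) ∣[1 - (r : ℤ)] γ =
        (ψ ((γ 1 1 : ℤ) : ZMod N) * ψ₀ ((γ 1 1 : ℤ) : ZMod N₀) * eps (γ 1 1) ^ (2 * (r : ℤ) - 2)) •
          (f * theta0 ψ₀) := by
      funext z
      rw [← preSlash_two_mul, show 2 * (1 - (r : ℤ)) = (1 - 2 * (r : ℤ)) + 1 by ring, preSlash_mul]
      have hP := hf.slash_eq γ hγ z
      have hE : eps (γ 1 1) ^ (1 - 2 * (r : ℤ)) * eps (γ 1 1) * eps (γ 1 1) ^ (2 * (r : ℤ) - 2) = 1 := by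
        rw [← zpow_add_one₀ hε, ← zpow_add₀ hε,
          show 1 - 2 * (r : ℤ) + 1 + (2 * (r : ℤ) - 2) = 0 by ring, zpow_zero]
      rw [slash] at hP
      simp only [Pi.mul_apply, Pi.smul_apply, smul_eq_mul]
      have hQz := hQ z
      generalize preSlash (1 - 2 * (r : ℤ)) f γ z = P at *
      generalize preSlash 1 (theta0 ψ₀) γ z = Q at *
      generalize (kroneckerOdd (γ 1 0) (γ 1 1) : ℂ) = K at *
      generalize eps (γ 1 1) ^ (2 * (r : ℤ) - 2) = E at *
      generalize eps (γ 1 1) ^ (1 - 2 * (r : ℤ)) = E' at *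
      linear_combination (K * E * eps (γ 1 1) * Q) * hP +
        (K * E * ψ ((γ 1 1 : ℤ) : ZMod N) * f z) * hQz +
        (ψ ((γ 1 1 : ℤ) : ZMod N) * ψ₀ ((γ 1 1 : ℤ) : ZMod N₀) * f z * theta0 ψ₀ z * E) * hk -
        (P * Q * K ^ 2) * hE - P * Q * hk
    have hbol := iterate_normalizedDeriv_slash γ hh r
    rw [hslash, iterate_normalizedDeriv_smul _ hh] at hbol
    have hbz := congrFun hbol z
    -- The three factors come from the slash of weight k, from θ₀f, and from θ₀^(-2) θ₁. The total
    -- exponent 4r + 2 reduces to 2 since ε_d⁴ = 1, and ε_d² is the character (-1/d).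
    have hE : eps (γ 1 1) ^ (2 * (r : ℤ) + 3) * eps (γ 1 1) ^ (2 * (r : ℤ) - 2) * eps (γ 1 1) =
        eps (γ 1 1) ^ 2 := by
      rw [← zpow_add₀ hε, ← zpow_add_one₀ hε,
        show 2 * (r : ℤ) + 3 + (2 * (r : ℤ) - 2) + 1 = ((4 * r + 2 : ℕ) : ℤ) by push_cast; ring,
        zpow_natCast, pow_add, pow_mul, hε4, one_pow, one_mul]
    have hK0 : (kroneckerOdd (γ 1 0) (γ 1 1) : ℂ) ≠ 0 := by
      intro h; rw [h] at hk; norm_num at hk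
    have hQz := hQ z
    have hRz := hR z
    rw [slash, show 2 * (r : ℤ) + 3 = 2 * (1 + (r : ℤ)) + (-1 + -1 + 3) by ring, preSlash_mul,
      preSlash_mul, preSlash_mul, preSlash_inv, preSlash_two_mul, 
      show 2 * (1 + (r : ℤ)) + (-1 + -1 + 3) = 2 * (r : ℤ) + 3 by ring]
    simp only [Pi.mul_apply, Pi.inv_apply, Pi.smul_apply, smul_eq_mul] at hbz ⊢
    rw [← hbz]
    have hQ' : preSlash 1 (theta0 ψ₀) γ z = kroneckerOdd (γ 1 0) (γ 1 1) *
        ψ₀ ((γ 1 1 : ℤ) : ZMod N₀) * theta0 ψ₀ z / eps (γ 1 1) := by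
      rw [eq_div_iff hε, ← hQz, mul_comm]
    have hR' : preSlash 3 (theta1 ψ₁) γ z = kroneckerOdd (γ 1 0) (γ 1 1) *
        ψ₁ ((γ 1 1 : ℤ) : ZMod N₁) * theta1 ψ₁ z / eps (γ 1 1) := by
      rw [eq_div_iff hε, ← hRz, mul_comm]
    rw [hQ', hR', ← hE]
    generalize (normalizedDerivOfComplex^[r] (f * theta0 ψ₀)) z = Dh
    generalize eps (γ 1 1) ^ (2 * (r : ℤ) - 2) = E
    generalize eps (γ 1 1) ^ (2 * (r : ℤ) + 3) = E'
    field_simp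
  -- Bol's identity for an arbitrary γ moves the slash inside D^r, so that only the behaviour of f,
  -- θ₀ and θ₁ at the cusp is needed.
  · have h1 : preSlash (2 * (r : ℤ) + 3) (normalizedDerivOfComplex^[r] (f * theta0 ψ₀) *
        ((theta0 ψ₀)⁻¹ * (theta0 ψ₀)⁻¹ * theta1 ψ₁)) γ =
        normalizedDerivOfComplex^[r] (preSlash (1 - 2 * (r : ℤ)) f γ * preSlash 1 (theta0 ψ₀) γ) *
          ((preSlash 1 (theta0 ψ₀) γ)⁻¹ * (preSlash 1 (theta0 ψ₀) γ)⁻¹ * preSlash 3 (theta1 ψ₁) γ) := by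
      rw [show 2 * (r : ℤ) + 3 = 2 * (1 + (r : ℤ)) + (-1 + -1 + 3) by ring, preSlash_mul,
        preSlash_mul, preSlash_mul, preSlash_inv, preSlash_two_mul,
        ← iterate_normalizedDeriv_slash γ hh, ← preSlash_two_mul,
        show 2 * (1 - (r : ℤ)) = (1 - 2 * (r : ℤ)) + 1 by ring, preSlash_mul]
    have m0 : MeromorphicAtInfty (preSlash 1 (theta0 ψ₀) γ) := by
      rw [theta0_eq_smul hψ₀even hψ₀, preSlash_smul]
      exact (meromorphicAtInfty_preSlash_charTheta (ν := 0) (by norm_num) ψ₀ γ).smul _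
    have m1 : MeromorphicAtInfty (preSlash 3 (theta1 ψ₁) γ) := by
      rw [theta1_eq_smul hψ₁odd, preSlash_smul]
      exact (meromorphicAtInfty_preSlash_charTheta (ν := 1) le_rfl ψ₁ γ).smul _
    rw [h1]
    exact (((hf.meromorphic γ).mul m0).iterate_normalizedDeriv r).mul ((m0.inv.mul m0.inv).mul m1)

end HalfIntegralBol
end

/-! ### Assembly of the theorem. -/

theorem mainTheorem3 {N₀ N₁ : ℕ}
    (ψ₀ : DirichletCharacter ℂ N₀) (ψ₁ : DirichletCharacter ℂ N₁)
    (hψ₀prim : ψ₀.IsPrimitive) (hψ₁prim : ψ₁.IsPrimitive)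
    (hψ₀real : ∀ x, (ψ₀ x).im = 0) (hψ₁real : ∀ x, (ψ₁ x).im = 0)
    (hψ₀even : ψ₀.Even) (hψ₁odd : ψ₁.Odd) (hψ₀nontriv : ψ₀ ≠ 1)
    (hθ₀ : ∀ z : UpperHalfPlane, HalfIntegralBol.theta0 ψ₀ z ≠ 0)
    (hθ₁ : ∀ z : UpperHalfPlane, HalfIntegralBol.theta1 ψ₁ z ≠ 0)
    -- the weight is `k = r + 3 / 2`, so that twice the weights `2 - k` and `k`
    -- are `1 - 2 * r` and `2 * r + 3`
    (r : ℕ) {N : ℕ} (hNpos : 0 < N) (hN : Nat.lcm (4 * N₀ ^ 2) (4 * N₁ ^ 2) ∣ N)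
    (ψ : DirichletCharacter ℂ N) :
    (∃ C : ℝ, ∀ n : ℤ, ‖HalfIntegralBol.ell r n‖ ≤ C) ∧
    ∃ L : HalfIntegralBol.WeaklyHolomorphicForms (1 - 2 * (r : ℤ)) N ψ →ₗ[ℂ]
        HalfIntegralBol.WeaklyHolomorphicForms (2 * (r : ℤ) + 3) N
          (HalfIntegralBol.targetCharacter hN ψ ψ₀ ψ₁),
      (∀ f, (L f : UpperHalfPlane → ℂ) = HalfIntegralBol.bolOperator ψ₀ ψ₁ 0 r f) ∧
      ∃ A : ℤ → ℤ → ℂ,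
        ∀ (f : HalfIntegralBol.WeaklyHolomorphicForms (1 - 2 * (r : ℤ)) N ψ)
          (n₀ : ℤ) (c : ℤ → ℂ),
          HalfIntegralBol.HasFourierExpansion f n₀ c →
          ∃ b : ℤ → ℂ, HalfIntegralBol.HasFourierExpansion (L f) n₀ b ∧
            (∀ n : ℤ, n ≠ 0 →
              b n = c n * HalfIntegralBol.ell r n * (n : ℂ) ^ ((r : ℂ) + 1 / 2)
                + ∑ l ∈ Finset.Ico (-n₀) n, A n l * c l) ∧
            b 0 = c 0 + ∑ l ∈ Finset.Ico (-n₀) 0, A 0 l * c l := by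
  -- A zero modulus N₀ or N₁ would make the least common multiple 0 and force N = 0.
  have hN0 : N ≠ 0 := hNpos.ne'
  have : NeZero N₀ := ⟨by
    rintro rfl
    simp at hN; exact hN0 hN⟩
  have : NeZero N₁ := ⟨by
    rintro rfl
    simp at hN; exact hN0 hN⟩
  have h0 := HalfIntegralBol.dirichlet_map_zero hψ₀nontriv
  have hd0 := HalfIntegralBol.mdifferentiable_theta0 hψ₀even h0
  refine ⟨⟨2 ^ r, HalfIntegralBol.norm_ell_le r⟩, ?_⟩
  refine ⟨{ toFun := fun f => ⟨HalfIntegralBol.bolOperator ψ₀ ψ₁ 0 r f,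
              HalfIntegralBol.isWeaklyHolomorphic_bolOperator hψ₀even hψ₁odd h0 hθ₀ r hN f.2⟩
            map_add' := fun f g => Subtype.ext ?_
            map_smul' := fun a f => Subtype.ext ?_ }, fun f => rfl, ?_⟩
  · have e : ((f + g : HalfIntegralBol.WeaklyHolomorphicForms _ N ψ) : UpperHalfPlane → ℂ) *
        HalfIntegralBol.theta0 ψ₀ = f.1 * HalfIntegralBol.theta0 ψ₀ + g.1 * HalfIntegralBol.theta0 ψ₀ :=
      add_mul _ _ _
    change HalfIntegralBol.bolOperator ψ₀ ψ₁ 0 r _ = HalfIntegralBol.bolOperator ψ₀ ψ₁ 0 r f.1 +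
      HalfIntegralBol.bolOperator ψ₀ ψ₁ 0 r g.1
    rw [HalfIntegralBol.bolOperator_zero_eq, HalfIntegralBol.bolOperator_zero_eq,
      HalfIntegralBol.bolOperator_zero_eq, e,
      HalfIntegralBol.iterate_normalizedDeriv_add (f.2.holo.mul hd0) (g.2.holo.mul hd0), add_mul]
  · have e : ((a • f : HalfIntegralBol.WeaklyHolomorphicForms _ N ψ) : UpperHalfPlane → ℂ) *
        HalfIntegralBol.theta0 ψ₀ = a • (f.1 * HalfIntegralBol.theta0 ψ₀) :=
      smul_mul_assoc _ _ _
    change HalfIntegralBol.bolOperator ψ₀ ψ₁ 0 r _ = a • HalfIntegralBol.bolOperator ψ₀ ψ₁ 0 r f.1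
    rw [HalfIntegralBol.bolOperator_zero_eq, HalfIntegralBol.bolOperator_zero_eq, e,
      HalfIntegralBol.iterate_normalizedDeriv_smul _ (f.2.holo.mul hd0), smul_mul_assoc]
  · obtain ⟨t, ht, ht1⟩ := HalfIntegralBol.exists_theta0_expansion h0
    obtain ⟨s, hs, hs1⟩ := HalfIntegralBol.exists_theta1_expansion ψ₁
    obtain ⟨g, hg, hg1⟩ := ht.inv_sq ht1 hθ₀
    have hU := hg.mul hs
    -- The leading coefficient of θ₀^(-2) θ₁ at q^(-1) is the product of those of θ₀^(-2) at q^(-2)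
    -- and of θ₁ at q.
    obtain ⟨A, hA⟩ := HalfIntegralBol.exists_bol_coefficients ht ht1 hU (by simp [hg1, hs1]) r
    refine ⟨A, fun f n₀ c hf => ⟨fun n => c n * ((n : ℂ) + 1) ^ r +
      ∑ l ∈ Finset.Ico (-n₀) n, A n l * c l, ?_, fun n hn => ?_, ?_⟩⟩
    · change HalfIntegralBol.HasFourierExpansion (HalfIntegralBol.bolOperator ψ₀ ψ₁ 0 r f) n₀ _
      rw [HalfIntegralBol.bolOperator_zero_eq]
      exact hA f n₀ c hf
    · rw [mul_assoc (c n), HalfIntegralBol.ell_mul_cpow r hn]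
    · simp
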